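/- **Setting.** Let $M\ge 1$, $[M]=\{1,\dots,M\}$, and let $X_i(n)$, $i\in[M]$, $n\ge 1$, and $Z_i(n)$, $i\in[M]$, $n\ge 0$, be random elements on a measurable space $\Omega$, the $X_i(n)$ with values in a measurable space $\mathbb S$. For each $i$ let $\nu_i$ be a $\sigma$-finite measure on $\mathbb S$ and $f_{0i},f_{1i}$ two probability densities with respect to $\nu_i$. For each $A\subseteq[M]$ let $\mathsf P_A$ be a probability measure on $\Omega$, with expectation $\mathsf E_A$, under which all the $X_i(n)$ and $Z_i(n)$ are independent, each $Z_i(n)$ is uniform on $(0,1)$, and each $X_i(n)$ has density $f_{1i}$ if $i\in A$ and $f_{0i}$ if $i\notin A$. Assume that the Kullback--Leibler divergences $I_i=\int \log(f_{1i}/f_{0i})f_{1i}\,d\nu_i$ and $J_i=\int\log(f_{0i}/f_{1i})f_{0i}\,d\nu_i$ lie in $(0,\infty)$ for all $i$. **Policies.** For random sets $R(n)\subseteq[M]$, $n\ge1$, let $\mathcal F^R_0=\sigma(Z_i(0): i\in[M])$ and let $\mathcal F^R_n$ be generated by $\mathcal F^R_{n-1}$, the $Z_i(n)$, $i\in[M]$,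 and the observations $X_i(n)$, $i\in R(n)$. $R$ is a *sampling rule* if $R(n)$ is $\mathcal F^R_{n-1}$-measurable for every $n\ge1$. A *policy* is a triplet $(R,T,\Delta)$ where $R$ is a sampling rule, $T$ is an $(\mathcal F^R_n)$-stopping time with values in $\{1,2,\dots\}\cup\{\infty\}$, and $\Delta\subseteq[M]$ satisfies $\{T=n,\Delta=D\}\in\mathcal F_n^R$ for all $n\geq 1$, $D\subseteq[M]$. Put $\pi_i^R(n)=\frac1n\sum_{m=1}^n\mathbf 1\{i\in R(m)\}$. For $K\in(0,M]$, the triplet satisfies the *sampling constraint* if, $\mathsf P_B$-almost surely for every $B\subseteq[M]$, $\frac1T\sum_{m=1}^T|R(m)|\le K$ on $\{T<\infty\}$. For $k\in[M]$ and $\alpha\in(0,1)$, $\mathcal C(\alpha;k,K)$ is the class of policies that satisfy the sampling constraint and $\mathsf P_B(T<\infty,\ |B\triangle\Delta|\ge k)\le\alpha$ for every $B\subseteq[M]$, and $\mathcal J_A(\alpha;k,K)=\inf\{\mathsf E_A[T]:(R,T,\Delta)\in\mathcal C(\alpha;k,K)\}$. **Sum-intersection rule.** For a sampling rule $R$ let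 $\Lambda_i^R(n)=\sum_{m\le n,\ i\in R(m)}\log\frac{f_{1i}(X_i(m))}{f_{0i}(X_i(m))}$. For $d>0$ let $T^R_{si}$ be the first $n\ge1$ at which the sum of the $k$ smallest numbers among $|\Lambda_j^R(n)|$, $j\in[M]$, is at least $d$ ($\infty$ if there is none), and let $\Delta^R_{si}=\{i:\Lambda_i^R(T^R_{si})>0\}$. **Optimal allocation.** Let $F_1(A)\le\dots\le F_M(A)$ be the numbers $I_i$ ($i\in A$), $J_j$ ($j\notin A$) in increasing order, and let $(1),\dots,(M)$ be an enumeration of the sources in which source $(i)$ has the number $F_i(A)$. Let $$V(k,K,\boldsymbol F(A))=\max_{c}\ \min_{U\subseteq[M],\,|U|=k}\ \sum_{i\in U}c_iF_i(A),$$ the maximum being over all $c\in[0,1]^M$ with $\sum_i c_i\le K$. Let $c'$ be a maximizer with the smallest $\ell^1$ norm among all maximizers, and let $c^*_{(i)}(A)=c'_i$ for $i\in[M]$. **Theorem.** Fix $k\in[M]$, $K\in(0,M]$, $A\subseteq[M]$ and a sampling rule $R$, not depending on $\alpha$. Take the threshold $d=|\log\alpha|+\log\binom Mk$, and suppose that for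 all sufficiently small $\alpha\in(0,1)$ the triplet $(R,T^R_{si},\Delta^R_{si})$ satisfies the sampling constraint. Suppose further that $$\sum_{n=1}^\infty\mathsf P_A\bigl(\pi_i^R(n)<c_i^*(A)-\epsilon\bigr)<\infty\qquad\text{for every } i\in[M]\text{ and every }\epsilon>0 .$$ Then $(R,T^R_{si},\Delta^R_{si})\in\mathcal C(\alpha;k,K)$ for all sufficiently small $\alpha\in(0,1)$, and, as $\alpha\to0$, $$\mathsf E_A[T^R_{si}]\ \sim\ \mathcal J_A(\alpha;k,K)\ \sim\ \frac{|\log\alpha|}{V(k,K,\boldsymbol F(A))},$$ where $x\sim y$ means $x/y\to1$. -/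

import Mathlib

open MeasureTheory ProbabilityTheory Filter Topology
open scoped NNReal ENNReal

noncomputable section

namespace AnomalyID

/-! ### The max-min allocation problem -/

/-- The set `D(K)` of vectors in `[0,1]^M` whose coordinates add up to at most `K`. -/
def allocSet (M : ℕ) (K : ℝ) : Set (Fin M → ℝ) :=
  {c | (∀ i, 0 ≤ c i ∧ c i ≤ 1) ∧ ∑ i, c i ≤ K}

/-- The minimum of `∑_{i ∈ U} c_i L_i` over the subsets `U` of size `κ`
(a minimum over a finite set, non-empty when `κ ≤ M`). -/
def minSum {M : ℕ} (κ : ℕ) (L c : Fin M → ℝ) : ℝ :=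
  ⨅ U : {U : Finset (Fin M) // U.card = κ}, ∑ i ∈ U.1, c i * L i

/-- The value `V(κ, K, L)` of the max-min problem. -/
def optValue {M : ℕ} (κ : ℕ) (K : ℝ) (L : Fin M → ℝ) : ℝ :=
  sSup (minSum κ L '' allocSet M K)

/-- `c` attains the maximum of `minSum κ L` over `D(K)`. -/
def IsMaximizer {M : ℕ} (κ : ℕ) (K : ℝ) (L c : Fin M → ℝ) : Prop :=
  c ∈ allocSet M K ∧ ∀ b ∈ allocSet M K, minSum κ L b ≤ minSum κ L c

/-- `c` is a maximizer of least `ℓ¹` norm among all the maximizers. -/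
def IsMinNormMaximizer {M : ℕ} (κ : ℕ) (K : ℝ) (L c : Fin M → ℝ) : Prop :=
  IsMaximizer κ K L c ∧ ∀ b, IsMaximizer κ K L b → ∑ i, |c i| ≤ ∑ i, |b i|

/-! ### The statistical model -/

/-- The probability distribution with density `f` with respect to `ν`. -/
def lawOf {S : Type*} [MeasurableSpace S] (ν : Measure S) (f : S → ℝ≥0) : Measure S :=
  ν.withDensity fun x => (f x : ℝ≥0∞)

/-- `M` independent data sources with iid observations `X i n` (`n ≥ 1`), independent
randomization variables `Z i n` (`n ≥ 0`) uniform on `(0,1)`, and for every subset `A` of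
sources the probability measure `P A` under which exactly the sources in `A` are anomalous,
i.e. have density `f₁`. The variable `X i 0` is never used and is left unconstrained. -/
structure Model (M : ℕ) (S Ω : Type*) [MeasurableSpace S] [MeasurableSpace Ω] where
  ν : Fin M → Measure S
  f₀ : Fin M → S → ℝ≥0
  f₁ : Fin M → S → ℝ≥0
  X : Fin M → ℕ → Ω → S
  Z : Fin M → ℕ → Ω → ℝ
  P : Finset (Fin M) → Measure Ω
  sigmaFinite : ∀ i, SigmaFinite (ν i)
  measurable_f₀ : ∀ i, Measurable (f₀ i)
  measurable_f₁ : ∀ i, Measurable (f₁ i)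
  measurable_X : ∀ i n, Measurable (X i (n + 1))
  measurable_Z : ∀ i n, Measurable (Z i n)
  isProbabilityMeasure : ∀ A, IsProbabilityMeasure (P A)
  law_X : ∀ A i n, (P A).map (X i (n + 1)) = lawOf (ν i) (if i ∈ A then f₁ i else f₀ i)
  law_Z : ∀ A i n, (P A).map (Z i n) = volume.restrict (Set.Ioo (0 : ℝ) 1)
  indep : ∀ A, iIndep
    (Sum.elim
      (fun p : Fin M × ℕ => MeasurableSpace.comap (X p.1 (p.2 + 1)) inferInstance)
      (fun p : Fin M × ℕ => MeasurableSpace.comap (Z p.1 p.2) inferInstance)) (P A)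
  /-- The two Kullback-Leibler divergences of each source are positive and finite. -/
  kl_pos₁ : ∀ i, InformationTheory.klDiv (lawOf (ν i) (f₁ i)) (lawOf (ν i) (f₀ i)) ≠ 0
  kl_fin₁ : ∀ i, InformationTheory.klDiv (lawOf (ν i) (f₁ i)) (lawOf (ν i) (f₀ i)) ≠ ⊤
  kl_pos₀ : ∀ i, InformationTheory.klDiv (lawOf (ν i) (f₀ i)) (lawOf (ν i) (f₁ i)) ≠ 0
  kl_fin₀ : ∀ i, InformationTheory.klDiv (lawOf (ν i) (f₀ i)) (lawOf (ν i) (f₁ i)) ≠ ⊤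

/-- A sampling rule (set sampled at each time `n ≥ 1`; the value at `0` is never used),
a stopping time with values in `{1, 2, …, ∞}`, and a decision (meaningful once stopped). -/
structure Triplet (M : ℕ) (Ω : Type*) where
  R : ℕ → Ω → Finset (Fin M)
  T : Ω → ℕ∞
  Δ : Ω → Finset (Fin M)

/-- The proportion `π_i^R(n)` of times source `i` is sampled among the first `n` instants. -/
def freq {M : ℕ} {Ω : Type*} (R : ℕ → Ω → Finset (Fin M)) (i : Fin M) (n : ℕ) (ω : Ω) : ℝ :=
  (∑ m ∈ Finset.Icc 1 n, if i ∈ R m ω then (1 : ℝ) else 0) / n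

namespace Model

variable {M : ℕ} {S Ω : Type*} [MeasurableSpace S] [MeasurableSpace Ω] (𝓜 : Model M S Ω)

/-- `I_i`, the Kullback-Leibler divergence of `f₁` from `f₀`. -/
def I (i : Fin M) : ℝ :=
  (InformationTheory.klDiv (lawOf (𝓜.ν i) (𝓜.f₁ i)) (lawOf (𝓜.ν i) (𝓜.f₀ i))).toReal

/-- `J_i`, the Kullback-Leibler divergence of `f₀` from `f₁`. -/
def J (i : Fin M) : ℝ :=
  (InformationTheory.klDiv (lawOf (𝓜.ν i) (𝓜.f₀ i)) (lawOf (𝓜.ν i) (𝓜.f₁ i))).toReal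

/-- The information number of source `i` under `P A`: `I_i` if `i ∈ A`, else `J_i`. -/
def info (A : Finset (Fin M)) (i : Fin M) : ℝ := if i ∈ A then 𝓜.I i else 𝓜.J i

/-- `F(A)`: the numbers `info A i` in increasing order. -/
def F (A : Finset (Fin M)) : Fin M → ℝ := 𝓜.info A ∘ Tuple.sort (𝓜.info A)

/-- The `σ`-algebra `F_n^R` of the data collected up to time `n`. Since the set `R (n+1)` is
random, the observations at time `n + 1` contribute the events
`{i ∈ R (n+1), X_i (n+1) ∈ B}`. -/
@[reducible] def filt (R : ℕ → Ω → Finset (Fin M)) : ℕ → MeasurableSpace Ω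
  | 0 => ⨆ i, MeasurableSpace.comap (𝓜.Z i 0) inferInstance
  | n + 1 => filt R n ⊔ (⨆ i, MeasurableSpace.comap (𝓜.Z i (n + 1)) inferInstance) ⊔
      ⨆ i, MeasurableSpace.generateFrom
        {E | ∃ B : Set S, MeasurableSet B ∧ E = {ω | i ∈ R (n + 1) ω ∧ 𝓜.X i (n + 1) ω ∈ B}}

/-- `R (n+1)` is determined by the data collected up to time `n`. -/
def IsSamplingRule (R : ℕ → Ω → Finset (Fin M)) : Prop :=
  ∀ (n : ℕ) (D : Finset (Fin M)), MeasurableSet[𝓜.filt R n] {ω | R (n + 1) ω = D}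

/-- A sampling rule, a stopping time `T ≥ 1` (possibly infinite) of the induced filtration,
and a decision that is measurable at the time of stopping. -/
def IsPolicy (p : Triplet M Ω) : Prop :=
  𝓜.IsSamplingRule p.R ∧
  (∀ ω, 1 ≤ p.T ω) ∧
  (∀ n : ℕ, 1 ≤ n → MeasurableSet[𝓜.filt p.R n] {ω | p.T ω = n}) ∧
  (∀ n : ℕ, 1 ≤ n → ∀ D : Finset (Fin M),
    MeasurableSet[𝓜.filt p.R n] {ω | p.T ω = n ∧ p.Δ ω = D})

/-- Upon stopping, the average number of observations per time instant is at most `K`. -/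
def SamplingConstraint (K : ℝ) (p : Triplet M Ω) : Prop :=
  ∀ A, ∀ᵐ ω ∂(𝓜.P A), ∀ n : ℕ, p.T ω = n →
    (∑ m ∈ Finset.Icc 1 n, ((p.R m ω).card : ℝ)) / n ≤ K

/-- Whatever the set of anomalous sources, the probability of stopping and making at least `k`
errors is at most `α`. -/
def ErrorConstraint (α : ℝ) (k : ℕ) (p : Triplet M Ω) : Prop :=
  ∀ A, 𝓜.P A {ω | p.T ω ≠ ⊤ ∧ k ≤ (symmDiff A (p.Δ ω)).card} ≤ ENNReal.ofReal α

/-- The class `C(α; k, K)` of policies. -/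
def policyClass (α : ℝ) (k : ℕ) (K : ℝ) : Set (Triplet M Ω) :=
  {p | 𝓜.IsPolicy p ∧ 𝓜.SamplingConstraint K p ∧ 𝓜.ErrorConstraint α k p}

/-- `E_A[T]`, an extended non-negative real. -/
def expT (A : Finset (Fin M)) (T : Ω → ℕ∞) : ℝ≥0∞ := ∫⁻ ω, (T ω : ℝ≥0∞) ∂(𝓜.P A)

/-- `J_A(α; k, K)`: the infimum of `E_A[T]` over the class `C(α; k, K)`. -/
def optTime (A : Finset (Fin M)) (α : ℝ) (k : ℕ) (K : ℝ) : ℝ≥0∞ :=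
  ⨅ p ∈ 𝓜.policyClass α k K, 𝓜.expT A p.T

/-- The local log-likelihood ratio `Λ_i^R(n)`. -/
def llr (R : ℕ → Ω → Finset (Fin M)) (i : Fin M) (n : ℕ) (ω : Ω) : ℝ :=
  ∑ m ∈ Finset.Icc 1 n,
    if i ∈ R m ω then Real.log ((𝓜.f₁ i (𝓜.X i m ω) : ℝ) / (𝓜.f₀ i (𝓜.X i m ω) : ℝ)) else 0

/-- The absolute values of the log-likelihood ratios at time `n`, in increasing order. -/
def sortedAbsLLR (R : ℕ → Ω → Finset (Fin M)) (n : ℕ) (ω : Ω) : Fin M → ℝ :=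
  (fun j => |𝓜.llr R j n ω|) ∘ Tuple.sort (fun j => |𝓜.llr R j n ω|)

/-- First time `n ≥ 1` at which the sum of the `k` smallest absolute log-likelihood ratios
is at least `d` (infinite if there is none). -/
def siTime (R : ℕ → Ω → Finset (Fin M)) (k : ℕ) (d : ℝ) (ω : Ω) : ℕ∞ :=
  sInf ((fun n : ℕ => (n : ℕ∞)) ''
    {n : ℕ | 1 ≤ n ∧ d ≤ ∑ i : Fin M with i.val < k, 𝓜.sortedAbsLLR R n ω i})

/-- The sources whose log-likelihood ratio is positive upon stopping. -/
def siDecision (R : ℕ → Ω → Finset (Fin M)) (k : ℕ) (d : ℝ) (ω : Ω) : Finset (Fin M) :=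
  {i : Fin M | 0 < 𝓜.llr R i (𝓜.siTime R k d ω).toNat ω}

/-- The sum-intersection rule with sampling rule `R` and threshold `d`. -/
def siPolicy (R : ℕ → Ω → Finset (Fin M)) (k : ℕ) (d : ℝ) : Triplet M Ω where
  R := R
  T := 𝓜.siTime R k d
  Δ := 𝓜.siDecision R k d

end Model

/-- The threshold `|log α| + log (M choose k)`. -/
def threshold (M k : ℕ) (α : ℝ) : ℝ := |Real.log α| + Real.log (M.choose k : ℝ)

/-- `x(α) ∼ y(α)` as `α → 0`, `α > 0`. -/
def AsympEquiv (x y : ℝ → ℝ≥0∞) : Prop :=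
  Tendsto (fun α => x α / y α) (𝓝[>] 0) (𝓝 1)

end AnomalyID

end

namespace AnomalyID

/-! ### Log-likelihood ratio of two densities -/

section Densities

variable {S : Type*} [MeasurableSpace S] {ν : Measure S} {f g : S → ℝ≥0}

/-! The optimal time and the expected time of the sum-intersection rule are squeezed between two
bounds that agree to first order with |log α| / V. Both bounds rest on one change of measure,
`IsSamplingRule.setLIntegral_lr`: on events of F_n^R, flipping the hypotheses of the sources in U
turns P_A into the measure with density exp(-∑_{i ∈ U} S_i(n)), where S_i (`slr`) is the
log-likelihood ratio of source i oriented in favour of A.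

Lower bound. Let a policy stop with W = A △ Δ of fewer than k elements, and let |U| = k. Flipping
the sources in U \ W makes every source of U an error, an event of probability at most α under the
flipped measure. The inequality -log α ≤ x + exp(-x)/α, with x the sum of S_i over U \ W, and s +
exp(-s) ≥ 0, which restores the missing sources of U, give a pathwise bound
(`neg_log_mul_indicator_le`). Integrating it for the rule switched off at T, by Wald's identity
(`integral_slr`), bounds |log α| P_A(T ≤ N, |W| < k) by ∑_{i ∈ U} F_i E[count_i] + k + 2^M, with F_i
the information number of source i. The vector E[count_i] / E[T] is a feasible allocation, so a
suitable U makes the sum at most V E[T]. Letting N → ∞ yields |log α| (1 - α) ≤ V E[T] + k + 2^M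
(`neg_log_mul_le_of_mem_policyClass`), without any limit theorem.

Upper bound. If the sum-intersection rule errs on all of U, the likelihood ratio for flipping U is
at least e^d; a union bound over the k-subsets controls the error (`errorConstraint_siPolicy`). If
the rule has not stopped at n ≥ d / (V - kδ), then some |Λ_i(n)| is below n (c_i* F_i - δ). Either
source i was sampled too rarely, which is summable by hypothesis, or a Chernoff bound applies. The
latter needs no moments beyond finite divergences, since exp(-S) has mean one for a single
observation. Summing tails gives E[T] ≤ d / (V - kδ) + C with C independent of d
(`exists_expT_siTime_le`). -/

theorem ae_imp_of_lawOf_absolutelyContinuous (hf : Measurable f) (hg : Measurable g)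
    (h : lawOf ν g ≪ lawOf ν f) : ∀ᵐ x ∂ν, f x = 0 → g x = 0 := by
  have hfm : Measurable fun x => (f x : ℝ≥0∞) := hf.coe_nnreal_ennreal
  have hgm : Measurable fun x => (g x : ℝ≥0∞) := hg.coe_nnreal_ennreal
  have h0 : lawOf ν f {x | f x = 0} = 0 := by
    rw [lawOf, withDensity_apply_eq_zero hfm]
    convert measure_empty (μ := ν)
    ext x
    simp
  have h1 := h h0
  rw [lawOf, withDensity_apply_eq_zero hgm] at h1
  rw [ae_iff]
  convert h1 using 2
  ext x
  simp [and_comm]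

/-- Off the common null set the exponential is `g / f`. Where `f` vanishes so does `g`, and the junk
value of the logarithm is multiplied by zero. -/
theorem lawOf_withDensity_exp_neg_log (hf : Measurable f) (hg : Measurable g)
    (hfg : lawOf ν f ≪ lawOf ν g) (hgf : lawOf ν g ≪ lawOf ν f) :
    (lawOf ν f).withDensity
      (fun x => ENNReal.ofReal (Real.exp (-Real.log ((f x : ℝ) / (g x : ℝ))))) = lawOf ν g := by
  have hm : Measurable
      fun x => ENNReal.ofReal (Real.exp (-Real.log ((f x : ℝ) / (g x : ℝ)))) := by fun_prop
  rw [lawOf, ← withDensity_mul _ hf.coe_nnreal_ennreal hm, lawOf]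
  apply withDensity_congr_ae
  filter_upwards [ae_imp_of_lawOf_absolutelyContinuous hf hg hgf,
    ae_imp_of_lawOf_absolutelyContinuous hg hf hfg] with x h1 h2
  by_cases h0 : f x = 0
  · simp [h0, h1 h0]
  · have hg0 : g x ≠ 0 := fun h => h0 (h2 h)
    have p1 : (0 : ℝ) < f x := by exact_mod_cast pos_iff_ne_zero.2 h0
    have p2 : (0 : ℝ) < g x := by exact_mod_cast pos_iff_ne_zero.2 hg0
    simp only [Pi.mul_apply]
    rw [Real.exp_neg, Real.exp_log (by positivity), ← ENNReal.ofReal_coe_nnreal (p := f x),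
      ← ENNReal.ofReal_coe_nnreal (p := g x), ← ENNReal.ofReal_mul p1.le]
    congr 1
    field_simp

/-- Links the Radon-Nikodym log-likelihood ratio, through which `klDiv` is defined, to the explicit
quotient of densities: `f / g` is the density of one law with respect to the other. -/
theorem llr_lawOf_ae_eq [SigmaFinite ν] (hf : Measurable f) (hg : Measurable g)
    (hfg : lawOf ν f ≪ lawOf ν g) :
    MeasureTheory.llr (lawOf ν f) (lawOf ν g) =ᵐ[lawOf ν f]
      fun x => Real.log ((f x : ℝ) / (g x : ℝ)) := by
  have hfm : Measurable fun x => (f x : ℝ≥0∞) := hf.coe_nnreal_ennreal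
  have hgm : Measurable fun x => (g x : ℝ≥0∞) := hg.coe_nnreal_ennreal
  have hq : Measurable fun x => (f x : ℝ≥0∞) / g x := hfm.div hgm
  have : SigmaFinite (lawOf ν g) := SigmaFinite.withDensity g
  have key : lawOf ν f = (lawOf ν g).withDensity fun x => (f x : ℝ≥0∞) / g x := by
    rw [lawOf, lawOf, ← withDensity_mul _ hgm hq]
    apply withDensity_congr_ae
    filter_upwards [ae_imp_of_lawOf_absolutelyContinuous hg hf hfg] with x h2
    by_cases h0 : g x = 0
    · simp [h0, h2 h0]
    · simp only [Pi.mul_apply]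
      rw [ENNReal.mul_div_cancel (by exact_mod_cast h0) ENNReal.coe_ne_top]
  have h := Measure.rnDeriv_withDensity (lawOf ν g) hq
  rw [← key] at h
  filter_upwards [hfg.ae_le h] with x hx
  simp only [MeasureTheory.llr]
  rw [hx]
  simp [ENNReal.toReal_div]

theorem integrable_log_div_lawOf [SigmaFinite ν] (hf : Measurable f) (hg : Measurable g)
    (h : InformationTheory.klDiv (lawOf ν f) (lawOf ν g) ≠ ⊤) :
    Integrable (fun x => Real.log ((f x : ℝ) / (g x : ℝ))) (lawOf ν f) := by
  obtain ⟨h1, h2⟩ := InformationTheory.klDiv_ne_top_iff.1 h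
  exact h2.congr (llr_lawOf_ae_eq hf hg h1)

theorem integral_log_div_lawOf [SigmaFinite ν] (hf : Measurable f) (hg : Measurable g)
    [IsProbabilityMeasure (lawOf ν f)] [IsProbabilityMeasure (lawOf ν g)]
    (h : InformationTheory.klDiv (lawOf ν f) (lawOf ν g) ≠ ⊤) :
    ∫ x, Real.log ((f x : ℝ) / (g x : ℝ)) ∂(lawOf ν f) =
      (InformationTheory.klDiv (lawOf ν f) (lawOf ν g)).toReal := by
  obtain ⟨h1, h2⟩ := InformationTheory.klDiv_ne_top_iff.1 h
  rw [InformationTheory.toReal_klDiv_of_measure_eq h1 (by simp)]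
  exact (integral_congr_ae (llr_lawOf_ae_eq hf hg h1)).symm

end Densities

/-! ### Exponential moments -/

/-- Under a one-sided exponential moment and a positive mean, some negative exponential moment is
smaller than one. -/
theorem exists_lintegral_exp_neg_mul_lt_one {S : Type*} [MeasurableSpace S] {μ : Measure S}
    [IsProbabilityMeasure μ] {Y : S → ℝ} (hY : Integrable Y μ)
    (hexp : Integrable (fun x => Real.exp (-Y x)) μ) (hpos : 0 < ∫ x, Y x ∂μ) :
    ∃ θ : ℝ, 0 < θ ∧ ∫⁻ x, ENNReal.ofReal (Real.exp (-θ * Y x)) ∂μ < 1 := by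
  -- Difference quotients at 0 of `t ↦ exp (-t * Y x)`, with step `1 / (n + 1)`. They converge to
  -- `-Y` and satisfy `-Y ≤ q n ≤ exp (-Y) - 1`, the upper bound by Bernoulli's inequality.
  -- Dominated convergence then makes their means eventually negative.
  let q : ℕ → S → ℝ := fun n x => ((n : ℝ) + 1) * (Real.exp (-(1 / ((n : ℝ) + 1)) * Y x) - 1)
  have hlim : Tendsto (fun n => ∫ x, q n x ∂μ) atTop (𝓝 (∫ x, -Y x ∂μ)) := by
    apply tendsto_integral_of_dominated_convergence (fun x => |Y x| + Real.exp (-Y x) + 1)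
    · intro n
      have := hY.aestronglyMeasurable
      have h2 : AEStronglyMeasurable
          (fun x => Real.exp (-(1 / ((n : ℝ) + 1)) * Y x)) μ :=
        Real.continuous_exp.comp_aestronglyMeasurable (this.const_mul _)
      exact (h2.sub aestronglyMeasurable_const).const_mul _
    · exact (hY.abs.add hexp).add (integrable_const 1)
    · intro n
      refine Eventually.of_forall fun x => ?_
      have hn : (0 : ℝ) < (n : ℝ) + 1 := by positivity
      have hlow : -Y x ≤ q n x := by
        have := Real.add_one_le_exp (-(1 / ((n : ℝ) + 1)) * Y x)
        calc -Y x = ((n : ℝ) + 1) * (-(1 / ((n : ℝ) + 1)) * Y x) := by field_simp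
          _ ≤ _ := mul_le_mul_of_nonneg_left (by linarith) hn.le
      have hup : q n x ≤ Real.exp (-Y x) - 1 := by
        have hb : -1 ≤ Real.exp (-(1 / ((n : ℝ) + 1)) * Y x) - 1 := by
          linarith [Real.exp_pos (-(1 / ((n : ℝ) + 1)) * Y x)]
        have := one_add_mul_le_pow (a := Real.exp (-(1 / ((n : ℝ) + 1)) * Y x) - 1)
          (by linarith) (n + 1)
        have e : (1 + (Real.exp (-(1 / ((n : ℝ) + 1)) * Y x) - 1)) ^ (n + 1)
            = Real.exp (-Y x) := by
          rw [add_sub_cancel, ← Real.exp_nat_mul]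
          congr 1
          push_cast
          field_simp
        rw [e] at this
        push_cast at this
        simp only [q]
        linarith
      rw [Real.norm_eq_abs, abs_le]
      have := Real.exp_pos (-Y x)
      constructor
      · linarith [le_abs_self (Y x)]
      · linarith [abs_nonneg (Y x)]
    · refine Eventually.of_forall fun x => ?_
      have hd : HasDerivAt (fun t : ℝ => Real.exp (-t * Y x)) (-Y x) 0 := by
        have h1 : HasDerivAt (fun t : ℝ => -t * Y x) (-1 * Y x) 0 :=
          (hasDerivAt_neg 0).mul_const _
        simpa using h1.exp
      have h2 := hd.tendsto_slope
      have h3 : Tendsto (fun n : ℕ => 1 / ((n : ℝ) + 1)) atTop (𝓝[≠] 0) :=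
        tendsto_nhdsWithin_iff.2 ⟨tendsto_one_div_add_atTop_nhds_zero_nat,
          Eventually.of_forall fun n => by
            simp only [Set.mem_compl_iff, Set.mem_singleton_iff]; positivity⟩
      refine (h2.comp h3).congr fun n => ?_
      simp [slope_def_field, q]
      ring
  rw [integral_neg] at hlim
  obtain ⟨n, hn⟩ := (hlim.eventually (gt_mem_nhds (neg_neg_of_pos hpos))).exists
  have hn1 : (0 : ℝ) < (n : ℝ) + 1 := by positivity
  refine ⟨1 / ((n : ℝ) + 1), by positivity, ?_⟩
  have hint : Integrable (fun x => Real.exp (-(1 / ((n : ℝ) + 1)) * Y x)) μ := by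
    refine Integrable.mono' (hexp.add (integrable_const 1))
      (Real.continuous_exp.comp_aestronglyMeasurable (hY.aestronglyMeasurable.const_mul _))
      (Eventually.of_forall fun x => ?_)
    rw [Real.norm_eq_abs, abs_of_pos (Real.exp_pos _)]
    simp only [Pi.add_apply]
    have hle : 1 / ((n : ℝ) + 1) ≤ 1 := by
      rw [div_le_one hn1]; linarith [(Nat.cast_nonneg n : (0 : ℝ) ≤ n)]
    have hp : 0 < 1 / ((n : ℝ) + 1) := by positivity
    rcases le_total 0 (Y x) with h | h
    · have : Real.exp (-(1 / ((n : ℝ) + 1)) * Y x) ≤ 1 := Real.exp_le_one_iff.2 (by nlinarith)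
      linarith [Real.exp_pos (-Y x)]
    · have : Real.exp (-(1 / ((n : ℝ) + 1)) * Y x) ≤ Real.exp (-Y x) :=
        Real.exp_le_exp.2 (by nlinarith)
      linarith
  rw [← ofReal_integral_eq_lintegral_ofReal hint
    (Eventually.of_forall fun x => (Real.exp_pos _).le), ENNReal.ofReal_lt_one]
  have e : ∫ x, q n x ∂μ
      = ((n : ℝ) + 1) * ((∫ x, Real.exp (-(1 / ((n : ℝ) + 1)) * Y x) ∂μ) - 1) := by
    simp only [q]
    rw [integral_const_mul, integral_sub hint (integrable_const 1)]
    simp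
  rw [e] at hn
  by_contra hcon
  push Not at hcon
  have : 0 ≤ ((n : ℝ) + 1) * ((∫ x, Real.exp (-(1 / ((n : ℝ) + 1)) * Y x) ∂μ) - 1) :=
    mul_nonneg hn1.le (by linarith)
  linarith

namespace Model

variable {M : ℕ} {S Ω : Type*} [MeasurableSpace S] [MeasurableSpace Ω] (𝓜 : Model M S Ω)

/-! ### The laws of the observations and their log-likelihood ratios -/

/-- The law of the observations of source `i` under `P A`. -/
noncomputable def law (A : Finset (Fin M)) (i : Fin M) : Measure S :=
  lawOf (𝓜.ν i) (if i ∈ A then 𝓜.f₁ i else 𝓜.f₀ i)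

/-- The log-likelihood ratio of the hypothesis which is true under `P A` against the
other one, for one observation of source `i`. -/
noncomputable def score (A : Finset (Fin M)) (i : Fin M) (x : S) : ℝ :=
  if i ∈ A then Real.log ((𝓜.f₁ i x : ℝ) / (𝓜.f₀ i x : ℝ))
  else Real.log ((𝓜.f₀ i x : ℝ) / (𝓜.f₁ i x : ℝ))

theorem isProbabilityMeasure_law (A : Finset (Fin M)) (i : Fin M) :
    IsProbabilityMeasure (𝓜.law A i) := by
  have := 𝓜.isProbabilityMeasure A
  rw [law, ← 𝓜.law_X A i 0]
  exact Measure.isProbabilityMeasure_map (𝓜.measurable_X i 0).aemeasurable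

theorem map_X (A : Finset (Fin M)) (i : Fin M) (n : ℕ) :
    (𝓜.P A).map (𝓜.X i (n + 1)) = 𝓜.law A i := 𝓜.law_X A i n

@[fun_prop]
theorem measurable_score (A : Finset (Fin M)) (i : Fin M) : Measurable (𝓜.score A i) := by
  have h1 := 𝓜.measurable_f₁ i
  have h0 := 𝓜.measurable_f₀ i
  by_cases h : i ∈ A <;> unfold score <;> simp only [h, if_true, if_false] <;> fun_prop

theorem isProbabilityMeasure_lawOf_f₁ (i : Fin M) :
    IsProbabilityMeasure (lawOf (𝓜.ν i) (𝓜.f₁ i)) := by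
  simpa [law] using 𝓜.isProbabilityMeasure_law Finset.univ i

theorem isProbabilityMeasure_lawOf_f₀ (i : Fin M) :
    IsProbabilityMeasure (lawOf (𝓜.ν i) (𝓜.f₀ i)) := by
  simpa [law] using 𝓜.isProbabilityMeasure_law ∅ i

theorem law_withDensity_exp_neg_score {A B : Finset (Fin M)} {i : Fin M}
    (h : i ∈ A ↔ i ∉ B) :
    (𝓜.law A i).withDensity (fun x => ENNReal.ofReal (Real.exp (-𝓜.score A i x))) =
      𝓜.law B i := by
  have h10 := (InformationTheory.klDiv_ne_top_iff.1 (𝓜.kl_fin₁ i)).1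
  have h01 := (InformationTheory.klDiv_ne_top_iff.1 (𝓜.kl_fin₀ i)).1
  by_cases hA : i ∈ A
  · simp only [law, score, hA, h.1 hA, if_true, if_false]
    exact lawOf_withDensity_exp_neg_log (𝓜.measurable_f₁ i) (𝓜.measurable_f₀ i) h10 h01
  · have hB : i ∈ B := by tauto
    simp only [law, score, hA, hB, if_true, if_false]
    exact lawOf_withDensity_exp_neg_log (𝓜.measurable_f₀ i) (𝓜.measurable_f₁ i) h01 h10

/-- A likelihood ratio has mean one under the true law. `Aᶜ` is merely a set of sources in which `i`
is flipped. -/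
theorem lintegral_exp_neg_score (A : Finset (Fin M)) (i : Fin M) :
    ∫⁻ x, ENNReal.ofReal (Real.exp (-𝓜.score A i x)) ∂𝓜.law A i = 1 := by
  have h := 𝓜.law_withDensity_exp_neg_score (A := A) (B := Aᶜ) (i := i) (by simp)
  have := 𝓜.isProbabilityMeasure_law Aᶜ i
  rw [← setLIntegral_univ, ← withDensity_apply _ MeasurableSet.univ, h, measure_univ]

theorem integrable_score (A : Finset (Fin M)) (i : Fin M) :
    Integrable (𝓜.score A i) (𝓜.law A i) := by
  have := 𝓜.sigmaFinite i
  by_cases hA : i ∈ A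
  · convert integrable_log_div_lawOf (𝓜.measurable_f₁ i) (𝓜.measurable_f₀ i)
      (𝓜.kl_fin₁ i) using 1
    · ext x; simp [score, hA]
    · simp [law, hA]
  · convert integrable_log_div_lawOf (𝓜.measurable_f₀ i) (𝓜.measurable_f₁ i)
      (𝓜.kl_fin₀ i) using 1
    · ext x; simp [score, hA]
    · simp [law, hA]

theorem integral_score (A : Finset (Fin M)) (i : Fin M) :
    ∫ x, 𝓜.score A i x ∂𝓜.law A i = 𝓜.info A i := by
  have := 𝓜.sigmaFinite i
  have := 𝓜.isProbabilityMeasure_lawOf_f₁ i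
  have := 𝓜.isProbabilityMeasure_lawOf_f₀ i
  by_cases hA : i ∈ A
  · simp only [score, law, info, I, hA, if_true]
    exact integral_log_div_lawOf (𝓜.measurable_f₁ i) (𝓜.measurable_f₀ i) (𝓜.kl_fin₁ i)
  · simp only [score, law, info, J, hA, if_false]
    exact integral_log_div_lawOf (𝓜.measurable_f₀ i) (𝓜.measurable_f₁ i) (𝓜.kl_fin₀ i)

theorem info_pos (A : Finset (Fin M)) (i : Fin M) : 0 < 𝓜.info A i := by
  by_cases hA : i ∈ A
  · simp only [info, hA, if_true]
    exact ENNReal.toReal_pos (𝓜.kl_pos₁ i) (𝓜.kl_fin₁ i)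
  · simp only [info, hA, if_false]
    exact ENNReal.toReal_pos (𝓜.kl_pos₀ i) (𝓜.kl_fin₀ i)

/-- The Chernoff exponent of the lower deviations of the log-likelihood ratio. -/
theorem exists_lintegral_exp_neg_score_lt_one (A : Finset (Fin M)) (i : Fin M) {a : ℝ}
    (ha : a < 𝓜.info A i) :
    ∃ θ : ℝ, 0 < θ ∧
      ∫⁻ x, ENNReal.ofReal (Real.exp (-θ * (𝓜.score A i x - a))) ∂𝓜.law A i < 1 := by
  have := 𝓜.isProbabilityMeasure_law A i
  -- The one-sided exponential moment comes for free, as the mean of a likelihood ratio.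
  have hexp : Integrable (fun x => Real.exp (-𝓜.score A i x)) (𝓜.law A i) := by
    refine ⟨by fun_prop, ?_⟩
    rw [hasFiniteIntegral_iff_ofReal (Eventually.of_forall fun x => (Real.exp_pos _).le),
      𝓜.lintegral_exp_neg_score]
    exact ENNReal.one_lt_top
  apply exists_lintegral_exp_neg_mul_lt_one
  · exact (𝓜.integrable_score A i).sub (integrable_const a)
  · refine (hexp.const_mul (Real.exp a)).congr (Eventually.of_forall fun x => ?_)
    simp only [← Real.exp_add]
    congr 1
    ring
  · rw [integral_sub (𝓜.integrable_score A i) (integrable_const a), 𝓜.integral_score]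
    simpa using ha

end Model

namespace Model

variable {M : ℕ} {S Ω : Type*} [MeasurableSpace S] [MeasurableSpace Ω] (𝓜 : Model M S Ω)

/-! ### Independence of the past and of the next observations -/

/-- The `σ`-algebras generated by each of the observations and randomization variables. -/
@[reducible]
def varSigma : (Fin M × ℕ) ⊕ (Fin M × ℕ) → MeasurableSpace Ω :=
  Sum.elim (fun p => MeasurableSpace.comap (𝓜.X p.1 (p.2 + 1)) inferInstance)
    (fun p => MeasurableSpace.comap (𝓜.Z p.1 p.2) inferInstance)

/-- The indices of the variables that are realized up to time `n`. -/
def pastIdx (M n : ℕ) : Set ((Fin M × ℕ) ⊕ (Fin M × ℕ)) :=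
  {q | Sum.elim (fun p => p.2 < n) (fun p => p.2 ≤ n) q}

/-- The index of a variable that is realized at time `n + 1`. -/
def nextIdx (M n : ℕ) : Fin M ⊕ Fin M → (Fin M × ℕ) ⊕ (Fin M × ℕ) :=
  Sum.map (fun i => (i, n)) (fun i => (i, n + 1))

/-- The `σ`-algebra generated by all the variables, observed or not, up to time `n`. -/
@[reducible] def past (n : ℕ) : MeasurableSpace Ω := ⨆ q ∈ pastIdx M n, 𝓜.varSigma q

theorem nextIdx_injective (n : ℕ) : Function.Injective (nextIdx M n) := by
  rintro (i | i) (j | j) h <;> simp_all [nextIdx]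

theorem disjoint_pastIdx_range_nextIdx (n : ℕ) :
    Disjoint (pastIdx M n) (Set.range (nextIdx M n)) := by
  rw [Set.disjoint_left]
  rintro _ h ⟨i | i, rfl⟩ <;> simp [nextIdx, pastIdx] at h

theorem varSigma_le (q : (Fin M × ℕ) ⊕ (Fin M × ℕ)) : 𝓜.varSigma q ≤ ‹MeasurableSpace Ω› := by
  rcases q with p | p
  · exact (𝓜.measurable_X p.1 p.2).comap_le
  · exact (𝓜.measurable_Z p.1 p.2).comap_le

theorem past_le (n : ℕ) : 𝓜.past n ≤ ‹MeasurableSpace Ω› :=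
  iSup₂_le fun q _ => 𝓜.varSigma_le q

theorem past_mono : Monotone 𝓜.past := by
  intro m n hmn
  refine biSup_mono fun q hq => ?_
  rcases q with p | p
  · exact lt_of_lt_of_le (show p.2 < m from hq) hmn
  · exact le_trans (show p.2 ≤ m from hq) hmn

theorem measurable_X_past (i : Fin M) (n : ℕ) : Measurable[𝓜.past (n + 1)] (𝓜.X i (n + 1)) := by
  have h : 𝓜.varSigma (Sum.inl (i, n)) ≤ 𝓜.past (n + 1) :=
    le_iSup₂_of_le (Sum.inl (i, n)) (show n < n + 1 by omega) le_rfl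
  exact (comap_measurable _).mono h le_rfl

theorem measurable_Z_past (i : Fin M) (n : ℕ) : Measurable[𝓜.past n] (𝓜.Z i n) := by
  have h : 𝓜.varSigma (Sum.inr (i, n)) ≤ 𝓜.past n :=
    le_iSup₂_of_le (Sum.inr (i, n)) (show n ≤ n from le_rfl) le_rfl
  exact (comap_measurable _).mono h le_rfl

theorem iIndep_varSigma (A : Finset (Fin M)) : iIndep 𝓜.varSigma (𝓜.P A) := 𝓜.indep A

theorem lintegral_comp_X (A : Finset (Fin M)) (i : Fin M) (n : ℕ) {g : S → ℝ≥0∞}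
    (hg : Measurable g) :
    ∫⁻ ω, g (𝓜.X i (n + 1) ω) ∂𝓜.P A = ∫⁻ x, g x ∂𝓜.law A i := by
  rw [← 𝓜.map_X A i n, lintegral_map hg (𝓜.measurable_X i n)]

/-- The variables realized at time `n + 1` are independent of each other and of the past. -/
theorem lintegral_past_mul_prod_next (A : Finset (Fin M)) (n : ℕ) {h : Ω → ℝ≥0∞}
    (hh : Measurable[𝓜.past n] h) {φ : Fin M → ℝ → ℝ≥0∞} (hφ : ∀ i, Measurable (φ i))
    {g : Fin M → S → ℝ≥0∞} (hg : ∀ i, Measurable (g i)) :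
    ∫⁻ ω, h ω * ((∏ i, g i (𝓜.X i (n + 1) ω)) * ∏ i, φ i (𝓜.Z i (n + 1) ω)) ∂𝓜.P A =
      (∫⁻ ω, h ω ∂𝓜.P A) * ((∏ i, ∫⁻ x, g i x ∂𝓜.law A i) *
        ∏ i, ∫⁻ z in Set.Ioo (0 : ℝ) 1, φ i z) := by
  have hprob := 𝓜.isProbabilityMeasure A
  let ψ : Fin M ⊕ Fin M → Ω → ℝ≥0∞ := Sum.elim (fun i ω => g i (𝓜.X i (n + 1) ω))
    (fun i ω => φ i (𝓜.Z i (n + 1) ω))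
  have hψ : ∀ q, Measurable[𝓜.varSigma (nextIdx M n q)] (ψ q) := by
    rintro (i | i)
    · exact (hg i).comp (comap_measurable _)
    · exact (hφ i).comp (comap_measurable _)
  have hind : iIndepFun ψ (𝓜.P A) := by
    rw [iIndepFun_iff_iIndep]
    exact iIndep_of_iIndep_of_le ((𝓜.iIndep_varSigma A).precomp (nextIdx_injective n))
      fun q => (hψ q).comap_le
  have hprod := lintegral_prod_eq_prod_lintegral_of_indepFun Finset.univ ψ hind
    fun q => (hψ q).mono (𝓜.varSigma_le _) le_rfl
  simp only [Fintype.prod_sum_type, ψ, Sum.elim_inl, Sum.elim_inr] at hprod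
  rw [lintegral_mul_eq_lintegral_mul_lintegral_of_independent_measurableSpace (𝓜.past_le n)
    (iSup₂_le fun q _ => 𝓜.varSigma_le q)
    (indep_iSup_of_disjoint 𝓜.varSigma_le (𝓜.iIndep_varSigma A)
      (disjoint_pastIdx_range_nextIdx n)) hh, hprod]
  · congr 2
    · exact Finset.prod_congr rfl fun i _ => 𝓜.lintegral_comp_X A i n (hg i)
    · refine Finset.prod_congr rfl fun i _ => ?_
      rw [← 𝓜.law_Z A i (n + 1), lintegral_map (hφ i) (𝓜.measurable_Z i (n + 1))]
  · have hle : ∀ q, 𝓜.varSigma (nextIdx M n q) ≤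
        ⨆ q ∈ Set.range (nextIdx M n), 𝓜.varSigma q :=
      fun q => le_iSup₂_of_le (nextIdx M n q) ⟨q, rfl⟩ le_rfl
    have hψ' := fun q => (hψ q).mono (hle q) le_rfl
    exact (Finset.univ.measurable_prod fun i _ => hψ' (Sum.inl i)).mul
      (Finset.univ.measurable_prod fun i _ => hψ' (Sum.inr i))

/-- The observation of one source at time `n + 1` is independent of the past. -/
theorem lintegral_past_mul_next (A : Finset (Fin M)) (i : Fin M) (n : ℕ) {h : Ω → ℝ≥0∞}
    (hh : Measurable[𝓜.past n] h) {g : S → ℝ≥0∞} (hg : Measurable g) :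
    ∫⁻ ω, h ω * g (𝓜.X i (n + 1) ω) ∂𝓜.P A =
      (∫⁻ ω, h ω ∂𝓜.P A) * ∫⁻ x, g x ∂𝓜.law A i := by
  rw [← 𝓜.lintegral_comp_X A i n hg]
  refine lintegral_mul_eq_lintegral_mul_lintegral_of_independent_measurableSpace (𝓜.past_le n)
    (iSup₂_le fun q _ => 𝓜.varSigma_le q)
    (indep_iSup_of_disjoint 𝓜.varSigma_le (𝓜.iIndep_varSigma A)
      (disjoint_pastIdx_range_nextIdx n)) hh ?_
  have hle : 𝓜.varSigma (nextIdx M n (Sum.inl i)) ≤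
      ⨆ q ∈ Set.range (nextIdx M n), 𝓜.varSigma q :=
    le_iSup₂_of_le (nextIdx M n (Sum.inl i)) ⟨_, rfl⟩ le_rfl
  exact Measurable.mono (hg.comp (comap_measurable _)) hle le_rfl

/-! ### The filtration of a sampling rule -/

variable {𝓜} {R : ℕ → Ω → Finset (Fin M)}

theorem filt_mono (𝓜 : Model M S Ω) (R : ℕ → Ω → Finset (Fin M)) : Monotone (𝓜.filt R) :=
  monotone_nat_of_le_succ fun _ => le_sup_of_le_left le_sup_left

theorem IsSamplingRule.measurableSet_mem (hR : 𝓜.IsSamplingRule R) (n : ℕ)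
    (p : Finset (Fin M) → Prop) : MeasurableSet[𝓜.filt R n] {ω | p (R (n + 1) ω)} := by
  have : {ω | p (R (n + 1) ω)} = ⋃ D ∈ {D | p D}, {ω | R (n + 1) ω = D} := by
    ext ω; simp
  rw [this]
  exact MeasurableSet.biUnion (Set.to_countable _) fun D _ => hR n D

theorem IsSamplingRule.filt_le_past (hR : 𝓜.IsSamplingRule R) (n : ℕ) :
    𝓜.filt R n ≤ 𝓜.past n := by
  induction n with
  | zero => exact iSup_le fun i => (𝓜.measurable_Z_past i 0).comap_le
  | succ n ih =>
    refine sup_le (sup_le (ih.trans (𝓜.past_mono n.le_succ))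
      (iSup_le fun i => (𝓜.measurable_Z_past i (n + 1)).comap_le)) (iSup_le fun i => ?_)
    apply MeasurableSpace.generateFrom_le
    rintro _ ⟨B, hB, rfl⟩
    exact MeasurableSet.inter
      (𝓜.past_mono n.le_succ _ (ih _ (hR.measurableSet_mem n fun D => i ∈ D)))
      (𝓜.measurable_X_past i n hB)

theorem IsSamplingRule.filt_le (hR : 𝓜.IsSamplingRule R) (n : ℕ) :
    𝓜.filt R n ≤ ‹MeasurableSpace Ω› := (hR.filt_le_past n).trans (𝓜.past_le n)

theorem IsSamplingRule.measurable_sampled (hR : 𝓜.IsSamplingRule R) (i : Fin M) (n : ℕ)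
    {s : S → ℝ} (hs : Measurable s) (c : ℝ) :
    Measurable[𝓜.filt R (n + 1)]
      fun ω => if i ∈ R (n + 1) ω then s (𝓜.X i (n + 1) ω) else c := by
  intro B hB
  have h1 : MeasurableSet[𝓜.filt R (n + 1)]
      {ω | i ∈ R (n + 1) ω ∧ 𝓜.X i (n + 1) ω ∈ s ⁻¹' B} := by
    have hle : MeasurableSpace.generateFrom
        {E | ∃ B : Set S, MeasurableSet B ∧ E = {ω | i ∈ R (n + 1) ω ∧ 𝓜.X i (n + 1) ω ∈ B}} ≤
        𝓜.filt R (n + 1) := le_sup_of_le_right (le_iSup_of_le i le_rfl)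
    exact hle _ (MeasurableSpace.measurableSet_generateFrom ⟨s ⁻¹' B, hs hB, rfl⟩)
  have h2 : MeasurableSet[𝓜.filt R (n + 1)] {ω | i ∉ R (n + 1) ω ∧ c ∈ B} :=
    filt_mono 𝓜 R n.le_succ _ (hR.measurableSet_mem n fun D => i ∉ D ∧ c ∈ B)
  convert MeasurableSet.union h1 h2 using 1
  ext ω
  by_cases h : i ∈ R (n + 1) ω <;> simp [h]

/-! ### Change of measure -/

variable (𝓜) in
/-- The log-likelihood ratio of source `i` at time `n`, oriented in favour of `P A`. -/
noncomputable def slr (A : Finset (Fin M)) (R : ℕ → Ω → Finset (Fin M)) (i : Fin M) (n : ℕ)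
    (ω : Ω) : ℝ :=
  ∑ m ∈ Finset.Icc 1 n, if i ∈ R m ω then 𝓜.score A i (𝓜.X i m ω) else 0

theorem slr_zero (A : Finset (Fin M)) (i : Fin M) (ω : Ω) : 𝓜.slr A R i 0 ω = 0 := by
  simp [slr]

theorem slr_succ (A : Finset (Fin M)) (i : Fin M) (n : ℕ) (ω : Ω) :
    𝓜.slr A R i (n + 1) ω = 𝓜.slr A R i n ω +
      if i ∈ R (n + 1) ω then 𝓜.score A i (𝓜.X i (n + 1) ω) else 0 := by
  rw [slr, Finset.sum_Icc_succ_top (by omega), slr]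

theorem slr_eq (A : Finset (Fin M)) (i : Fin M) (n : ℕ) (ω : Ω) :
    𝓜.slr A R i n ω = if i ∈ A then 𝓜.llr R i n ω else -𝓜.llr R i n ω := by
  have : ∀ x, Real.log ((𝓜.f₀ i x : ℝ) / (𝓜.f₁ i x : ℝ)) =
      -Real.log ((𝓜.f₁ i x : ℝ) / (𝓜.f₀ i x : ℝ)) := fun x => by
    rw [← Real.log_inv, inv_div]
  by_cases h : i ∈ A
  · simp [slr, llr, score, h]
  · simp only [slr, llr, score, h, if_false, this, ← Finset.sum_neg_distrib]
    refine Finset.sum_congr rfl fun m _ => ?_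
    split_ifs <;> simp

theorem abs_slr (A : Finset (Fin M)) (i : Fin M) (n : ℕ) (ω : Ω) :
    |𝓜.slr A R i n ω| = |𝓜.llr R i n ω| := by
  rw [slr_eq]; split_ifs <;> simp

theorem IsSamplingRule.measurable_slr (hR : 𝓜.IsSamplingRule R) (A : Finset (Fin M)) (i : Fin M)
    (n : ℕ) : Measurable[𝓜.filt R n] (𝓜.slr A R i n) := by
  induction n with
  | zero =>
    have : 𝓜.slr A R i 0 = fun _ => 0 := funext fun ω => slr_zero A i ω
    rw [this]; exact measurable_const
  | succ n ih =>
    have : 𝓜.slr A R i (n + 1) = fun ω => 𝓜.slr A R i n ω +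
      if i ∈ R (n + 1) ω then 𝓜.score A i (𝓜.X i (n + 1) ω) else 0 :=
      funext fun ω => slr_succ A i n ω
    rw [this]
    exact (ih.mono (filt_mono 𝓜 R n.le_succ) le_rfl).add
      (hR.measurable_sampled i n (𝓜.measurable_score A i) 0)

theorem IsSamplingRule.measurable_llr (hR : 𝓜.IsSamplingRule R) (i : Fin M)
    (n : ℕ) : Measurable[𝓜.filt R n] (𝓜.llr R i n) := by
  convert hR.measurable_slr Finset.univ i n using 1
  ext ω; simp [slr_eq]

variable (𝓜) in
/-- The likelihood ratio at time `n` of the hypothesis in which the sources in `U` have been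
changed against `A`. -/
noncomputable def lr (A U : Finset (Fin M)) (R : ℕ → Ω → Finset (Fin M)) (n : ℕ) (ω : Ω) :
    ℝ≥0∞ :=
  ENNReal.ofReal (Real.exp (-∑ i ∈ U, 𝓜.slr A R i n ω))

theorem lr_succ (A U : Finset (Fin M)) (n : ℕ) (ω : Ω) :
    𝓜.lr A U R (n + 1) ω = 𝓜.lr A U R n ω * ∏ i, if i ∈ R (n + 1) ω ∧ i ∈ U then
      ENNReal.ofReal (Real.exp (-𝓜.score A i (𝓜.X i (n + 1) ω))) else 1 := by
  have h : ∏ i, (if i ∈ R (n + 1) ω ∧ i ∈ U then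
      ENNReal.ofReal (Real.exp (-𝓜.score A i (𝓜.X i (n + 1) ω))) else 1) =
      ENNReal.ofReal (Real.exp (-∑ i ∈ U,
        if i ∈ R (n + 1) ω then 𝓜.score A i (𝓜.X i (n + 1) ω) else 0)) := by
    rw [← Finset.sum_neg_distrib, Real.exp_sum,
      ENNReal.ofReal_prod_of_nonneg fun i _ => (Real.exp_pos _).le,
      ← Finset.prod_subset (Finset.subset_univ U)]
    · refine Finset.prod_congr rfl fun i hi => ?_
      by_cases h : i ∈ R (n + 1) ω <;> simp [h, hi]
    · intro i _ hi
      simp [hi]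
  rw [h, lr, lr, ← ENNReal.ofReal_mul (Real.exp_pos _).le, ← Real.exp_add]
  simp only [slr_succ, Finset.sum_add_distrib, neg_add]

theorem IsSamplingRule.measurable_lr (hR : 𝓜.IsSamplingRule R) (A U : Finset (Fin M)) (n : ℕ) :
    Measurable[𝓜.filt R n] (𝓜.lr A U R n) :=
  (Real.measurable_exp.comp
    (U.measurable_sum fun i _ => hR.measurable_slr A i n).neg).ennreal_ofReal

/-- Used to cut an event along the values of the random sampled set; on each piece the set is
constant and independence applies. -/
theorem measure_eq_of_forall_fiber {α : Type*} [Countable α] {μ ν : Measure Ω} {r : Ω → α}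
    (hr : ∀ a, MeasurableSet {ω | r ω = a}) {s : Set Ω} (hs : MeasurableSet s)
    (h : ∀ a, μ (s ∩ {ω | r ω = a}) = ν (s ∩ {ω | r ω = a})) : μ s = ν s := by
  have hu : s = ⋃ a, s ∩ {ω | r ω = a} := by ext ω; simp
  have hd : Pairwise (Function.onFun Disjoint fun a => s ∩ {ω | r ω = a}) := by
    intro a b hab
    refine Set.disjoint_left.2 fun ω h1 h2 => hab ?_
    exact h1.2.symm.trans h2.2
  rw [hu, measure_iUnion hd fun a => hs.inter (hr a), measure_iUnion hd fun a => hs.inter (hr a)]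
  exact tsum_congr h

variable (𝓜) in
/-- A `π`-system that generates `F_{n+1}^R`. -/
def filtGen (R : ℕ → Ω → Finset (Fin M)) (n : ℕ) : Set (Set Ω) :=
  {s | ∃ (E : Set Ω) (C : Fin M → Set ℝ) (B : Fin M → Set S), MeasurableSet[𝓜.filt R n] E ∧
    (∀ i, MeasurableSet (C i)) ∧ (∀ i, MeasurableSet (B i)) ∧
    s = {ω | ω ∈ E ∧ (∀ i, 𝓜.Z i (n + 1) ω ∈ C i) ∧ ∀ i ∈ R (n + 1) ω, 𝓜.X i (n + 1) ω ∈ B i}}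

theorem isPiSystem_filtGen (n : ℕ) : IsPiSystem (𝓜.filtGen R n) := by
  rintro _ ⟨E, C, B, hE, hC, hB, rfl⟩ _ ⟨E', C', B', hE', hC', hB', rfl⟩ -
  refine ⟨E ∩ E', fun i => C i ∩ C' i, fun i => B i ∩ B' i, hE.inter hE',
    fun i => (hC i).inter (hC' i), fun i => (hB i).inter (hB' i), ?_⟩
  ext ω
  simp only [Set.mem_inter_iff, Set.mem_ofPred_eq]
  constructor
  · rintro ⟨⟨a, b, c⟩, a', b', c'⟩
    exact ⟨⟨a, a'⟩, fun i => ⟨b i, b' i⟩, fun i hi => ⟨c i hi, c' i hi⟩⟩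
  · rintro ⟨⟨a, a'⟩, b, c⟩
    exact ⟨⟨a, fun i => (b i).1, fun i hi => (c i hi).1⟩, a', fun i => (b i).2,
      fun i hi => (c i hi).2⟩

theorem univ_mem_filtGen (n : ℕ) : Set.univ ∈ 𝓜.filtGen R n :=
  ⟨Set.univ, fun _ => Set.univ, fun _ => Set.univ, MeasurableSet.univ,
    fun _ => MeasurableSet.univ, fun _ => MeasurableSet.univ, by simp⟩

theorem IsSamplingRule.filt_succ_le (hR : 𝓜.IsSamplingRule R) (n : ℕ) :
    𝓜.filt R (n + 1) ≤ MeasurableSpace.generateFrom (𝓜.filtGen R n) := by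
  classical
  refine sup_le (sup_le ?_ (iSup_le fun i => ?_)) (iSup_le fun i => ?_)
  · intro E hE
    refine MeasurableSpace.measurableSet_generateFrom ⟨E, fun _ => Set.univ, fun _ => Set.univ,
      hE, fun _ => MeasurableSet.univ, fun _ => MeasurableSet.univ, by simp⟩
  · rintro _ ⟨C, hC, rfl⟩
    refine MeasurableSpace.measurableSet_generateFrom ⟨Set.univ,
      fun j => if j = i then C else Set.univ, fun _ => Set.univ,
      MeasurableSet.univ, fun j => ?_, fun _ => MeasurableSet.univ, ?_⟩
    · dsimp only; split_ifs
      exacts [hC, MeasurableSet.univ]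
    · ext ω
      simp only [Set.mem_preimage, Set.mem_ofPred_eq, Set.mem_univ, true_and, implies_true,
        and_true]
      refine ⟨fun h j => ?_, fun h => by simpa using h i⟩
      split_ifs with hj
      · exact hj ▸ h
      · trivial
  · apply MeasurableSpace.generateFrom_le
    rintro _ ⟨B, hB, rfl⟩
    refine MeasurableSpace.measurableSet_generateFrom ⟨{ω | i ∈ R (n + 1) ω},
      fun _ => Set.univ, fun j => if j = i then B else Set.univ,
      hR.measurableSet_mem n fun D => i ∈ D, fun _ => MeasurableSet.univ, fun j => ?_, ?_⟩
    · dsimp only; split_ifs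
      exacts [hB, MeasurableSet.univ]
    · ext ω
      simp only [Set.mem_ofPred_eq, Set.mem_univ, implies_true, true_and]
      refine ⟨fun h => ⟨h.1, fun j _ => ?_⟩, fun h => ⟨h.1, by simpa using h.2 i h.1⟩⟩
      split_ifs with hj
      · exact hj ▸ h.2
      · trivial

theorem IsSamplingRule.measurableSet_of_mem_filtGen (hR : 𝓜.IsSamplingRule R) (n : ℕ) {s : Set Ω}
    (hs : s ∈ 𝓜.filtGen R n) : MeasurableSet s := by
  obtain ⟨E, C, B, hE, hC, hB, rfl⟩ := hs
  have h1 : MeasurableSet {ω | ∀ i, 𝓜.Z i (n + 1) ω ∈ C i} := by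
    rw [Set.ofPred_forall]
    exact MeasurableSet.iInter fun i => 𝓜.measurable_Z i (n + 1) (hC i)
  have h2 : MeasurableSet {ω | ∀ i ∈ R (n + 1) ω, 𝓜.X i (n + 1) ω ∈ B i} := by
    rw [Set.ofPred_forall]
    refine MeasurableSet.iInter fun i => ?_
    have : {ω | i ∈ R (n + 1) ω → 𝓜.X i (n + 1) ω ∈ B i} =
        {ω | i ∉ R (n + 1) ω} ∪ 𝓜.X i (n + 1) ⁻¹' B i := by
      ext ω; simp [imp_iff_not_or]
    rw [this]
    exact (hR.filt_le n _ (hR.measurableSet_mem n fun D => i ∉ D)).union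
      (𝓜.measurable_X i n (hB i))
  exact (hR.filt_le n _ hE).inter (h1.inter h2)

/-- The integral of the next likelihood ratio over a generating set on which the sampled set is
constant. -/
theorem IsSamplingRule.setLIntegral_lr_succ (hR : 𝓜.IsSamplingRule R) (A U : Finset (Fin M))
    (n : ℕ) (D : Finset (Fin M)) {E : Set Ω} {C : Fin M → Set ℝ} {B : Fin M → Set S}
    (hE : MeasurableSet[𝓜.filt R n] E) (hC : ∀ i, MeasurableSet (C i))
    (hB : ∀ i, MeasurableSet (B i)) (hED : ∀ ω ∈ E, R (n + 1) ω = D) :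
    ∫⁻ ω in {ω | ω ∈ E ∧ (∀ i, 𝓜.Z i (n + 1) ω ∈ C i) ∧
        ∀ i ∈ R (n + 1) ω, 𝓜.X i (n + 1) ω ∈ B i}, 𝓜.lr A U R (n + 1) ω ∂𝓜.P A =
      (∫⁻ ω in E, 𝓜.lr A U R n ω ∂𝓜.P A) *
        ((∏ i, 𝓜.law (symmDiff A U) i {x | i ∈ D → x ∈ B i}) *
          ∏ i, volume.restrict (Set.Ioo (0 : ℝ) 1) (C i)) := by
  classical
  have hs := hR.measurableSet_of_mem_filtGen n ⟨E, C, B, hE, hC, hB, rfl⟩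
  -- For `i ∉ D` the condition on the observation is vacuous, so that unsampled sources contribute a
  -- factor one.
  let g : Fin M → S → ℝ≥0∞ := fun i => Set.indicator {x | i ∈ D → x ∈ B i} fun x =>
    if i ∈ D ∧ i ∈ U then ENNReal.ofReal (Real.exp (-𝓜.score A i x)) else 1
  have hBm : ∀ i, MeasurableSet {x | i ∈ D → x ∈ B i} := fun i => by
    by_cases h : i ∈ D <;> simp [h, hB i]
  have hg : ∀ i, Measurable (g i) := fun i => by
    refine Measurable.indicator ?_ (hBm i)
    by_cases h : i ∈ D ∧ i ∈ U
    · simp only [h, and_self, if_true]; fun_prop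
    · simp only [h, if_false]; fun_prop
  have hgint : ∀ i, ∫⁻ x, g i x ∂𝓜.law A i =
      𝓜.law (symmDiff A U) i {x | i ∈ D → x ∈ B i} := fun i => by
    rw [lintegral_indicator (hBm i)]
    -- Three cases: a source in `U ∩ D` has its law tilted into the flipped one; a source in `U \ D`
    -- has total mass one under both laws; a source outside `U` has the same law under `A` and
    -- `symmDiff A U`.
    by_cases hU : i ∈ U
    · by_cases hD : i ∈ D
      · rw [← 𝓜.law_withDensity_exp_neg_score (A := A) (B := symmDiff A U) (i := i)
          (by simp [Finset.mem_symmDiff, hU]), withDensity_apply _ (hBm i)]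
        simp [hU, hD]
      · have h1 := 𝓜.isProbabilityMeasure_law A i
        have h2 := 𝓜.isProbabilityMeasure_law (symmDiff A U) i
        simp [hD]
    · have : 𝓜.law (symmDiff A U) i = 𝓜.law A i := by
        simp [law, Finset.mem_symmDiff, hU]
      simp [hU, this]
  have hLm : Measurable[𝓜.past n] (E.indicator (𝓜.lr A U R n)) :=
    ((hR.measurable_lr A U n).indicator hE).mono (hR.filt_le_past n) le_rfl
  have key := 𝓜.lintegral_past_mul_prod_next A n hLm
    (φ := fun i => (C i).indicator 1) (fun i => measurable_one.indicator (hC i)) hg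
  rw [lintegral_indicator (hR.filt_le n _ hE)] at key
  simp only [hgint, lintegral_indicator_one (hC _)] at key
  rw [← key, ← lintegral_indicator hs]
  refine lintegral_congr fun ω => ?_
  by_cases hω : ω ∈ E
  · have hD := hED ω hω
    simp only [g, Set.indicator_apply, Set.mem_ofPred_eq, hω, if_true, true_and, hD,
      Finset.prod_ite_zero, lr_succ, Finset.mem_univ, forall_true_left, Pi.one_apply,
      Finset.prod_const_one]
    by_cases h1 : ∀ i, 𝓜.Z i (n + 1) ω ∈ C i <;>
      by_cases h2 : ∀ i ∈ D, 𝓜.X i (n + 1) ω ∈ B i <;> simp [h1, h2]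
  · simp [hω]

/-- Change of measure on the events determined by the data collected up to time `n`. -/
theorem IsSamplingRule.setLIntegral_lr (hR : 𝓜.IsSamplingRule R) (A U : Finset (Fin M)) (n : ℕ)
    {E : Set Ω} (hE : MeasurableSet[𝓜.filt R n] E) :
    ∫⁻ ω in E, 𝓜.lr A U R n ω ∂𝓜.P A = 𝓜.P (symmDiff A U) E := by
  have hPA := 𝓜.isProbabilityMeasure A
  have hPB := 𝓜.isProbabilityMeasure (symmDiff A U)
  induction n generalizing E with
  | zero =>
    simp only [lr, slr_zero, Finset.sum_const_zero, neg_zero, Real.exp_zero, ENNReal.ofReal_one,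
      setLIntegral_one]
    -- At time 0 only the randomization variables are known, and they have the same joint law under
    -- every `P B`; it suffices to compare on rectangles.
    let 𝒞 : Set (Set Ω) := {s | ∃ C : Fin M → Set ℝ, (∀ i, MeasurableSet (C i)) ∧
      s = ⋂ i, 𝓜.Z i 0 ⁻¹' C i}
    have hinj : Function.Injective fun i : Fin M =>
        (Sum.inr (i, 0) : (Fin M × ℕ) ⊕ (Fin M × ℕ)) := by
      intro i j h; simpa using h
    have hval : ∀ (B : Finset (Fin M)) (C : Fin M → Set ℝ), (∀ i, MeasurableSet (C i)) →
        𝓜.P B (⋂ i, 𝓜.Z i 0 ⁻¹' C i) = ∏ i, volume.restrict (Set.Ioo (0 : ℝ) 1) (C i) := by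
      intro B C hC
      rw [((𝓜.iIndep_varSigma B).precomp hinj).meas_iInter fun i => ⟨C i, hC i, rfl⟩]
      refine Finset.prod_congr rfl fun i _ => ?_
      rw [← 𝓜.law_Z B i 0, Measure.map_apply (𝓜.measurable_Z i 0) (hC i)]
    have hle : 𝓜.filt R 0 ≤ MeasurableSpace.generateFrom 𝒞 := by
      classical
      refine iSup_le fun i => ?_
      rintro _ ⟨C, hC, rfl⟩
      refine MeasurableSpace.measurableSet_generateFrom
        ⟨fun j => if j = i then C else Set.univ, fun j => ?_, ?_⟩
      · dsimp only; split_ifs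
        exacts [hC, MeasurableSet.univ]
      · ext ω
        simp only [Set.mem_preimage, Set.mem_iInter]
        refine ⟨fun h j => ?_, fun h => by simpa using h i⟩
        split_ifs with hj
        · exact hj ▸ h
        · trivial
    refine ext_on_measurableSpace_of_generate_finite _ 𝒞 ?_ ?_ rfl ?_ (by simp) (hle _ hE)
    · rintro _ ⟨C, hC, rfl⟩
      rw [hval _ _ hC, hval _ _ hC]
    · apply MeasurableSpace.generateFrom_le
      rintro _ ⟨C, hC, rfl⟩
      exact MeasurableSet.iInter fun i => 𝓜.measurable_Z i 0 (hC i)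
    · rintro _ ⟨C, hC, rfl⟩ _ ⟨C', hC', rfl⟩ -
      refine ⟨fun i => C i ∩ C' i, fun i => (hC i).inter (hC' i), ?_⟩
      simp [Set.iInter_inter_distrib]
  | succ n ih =>
    have hw : ∀ s, MeasurableSet s → (𝓜.P A).withDensity (𝓜.lr A U R (n + 1)) s =
        ∫⁻ ω in s, 𝓜.lr A U R (n + 1) ω ∂𝓜.P A := fun s hs => withDensity_apply _ hs
    have hgen : ∀ s ∈ 𝓜.filtGen R n,
        (𝓜.P A).withDensity (𝓜.lr A U R (n + 1)) s = 𝓜.P (symmDiff A U) s := by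
      intro s hs
      have hsm := hR.measurableSet_of_mem_filtGen n hs
      obtain ⟨E, C, B, hE, hC, hB, rfl⟩ := hs
      refine measure_eq_of_forall_fiber (r := R (n + 1))
        (fun D => hR.filt_le n _ (hR n D)) hsm fun D => ?_
      have hED : MeasurableSet[𝓜.filt R n] (E ∩ {ω | R (n + 1) ω = D}) := hE.inter (hR n D)
      have hset : {ω | ω ∈ E ∧ (∀ i, 𝓜.Z i (n + 1) ω ∈ C i) ∧
          ∀ i ∈ R (n + 1) ω, 𝓜.X i (n + 1) ω ∈ B i} ∩ {ω | R (n + 1) ω = D} =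
          {ω | ω ∈ E ∩ {ω | R (n + 1) ω = D} ∧ (∀ i, 𝓜.Z i (n + 1) ω ∈ C i) ∧
          ∀ i ∈ R (n + 1) ω, 𝓜.X i (n + 1) ω ∈ B i} := by
        ext ω
        simp only [Set.mem_inter_iff, Set.mem_ofPred_eq]
        tauto
      have h1 := hR.setLIntegral_lr_succ A U n D hED hC hB fun ω h => h.2
      -- The same formula with nothing flipped computes the probability under `symmDiff A U`, and
      -- its product of laws is the one in `h1`. Only the factors carrying the past differ, and
      -- those agree by induction.
      have h2 := hR.setLIntegral_lr_succ (symmDiff A U) ∅ n D hED hC hB fun ω h => h.2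
      simp only [lr, Finset.sum_empty, neg_zero, Real.exp_zero, ENNReal.ofReal_one,
        setLIntegral_one] at h2
      rw [hset, hw _ (hset ▸ hsm.inter (hR.filt_le n _ (hR n D))), h1, h2, ih hED]
      rw [show symmDiff (symmDiff A U) ∅ = symmDiff A U from symmDiff_bot _]
    have huniv := hgen _ (univ_mem_filtGen n)
    have hfin : IsFiniteMeasure ((𝓜.P A).withDensity (𝓜.lr A U R (n + 1))) :=
      ⟨by rw [huniv]; exact measure_lt_top _ _⟩
    rw [← hw _ (hR.filt_le (n + 1) _ hE)]
    refine ext_on_measurableSpace_of_generate_finite _ (𝓜.filtGen R n) hgen ?_ rfl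
      (isPiSystem_filtGen n) huniv (hR.filt_succ_le n _ hE)
    exact MeasurableSpace.generateFrom_le fun s hs => hR.measurableSet_of_mem_filtGen n hs

end Model

namespace Model

variable {M : ℕ} {S Ω : Type*} [MeasurableSpace S] [MeasurableSpace Ω] {𝓜 : Model M S Ω}
  {R : ℕ → Ω → Finset (Fin M)}

/-! ### Predictable sampling -/

/-- The number of times source `i` is sampled up to time `n`. -/
def count (R : ℕ → Ω → Finset (Fin M)) (i : Fin M) (n : ℕ) (ω : Ω) : ℝ :=
  ∑ m ∈ Finset.Icc 1 n, if i ∈ R m ω then (1 : ℝ) else 0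

/-- For a past-predictable sampling of source `i`, the product of the values at the sampled
observations of a function with mean one has mean one. -/
theorem lintegral_prod_sampled (A : Finset (Fin M)) (i : Fin M)
    (hR : ∀ n, MeasurableSet[𝓜.past n] {ω | i ∈ R (n + 1) ω}) {g : S → ℝ≥0∞}
    (hg : Measurable g) (hg1 : ∫⁻ x, g x ∂𝓜.law A i = 1) (n : ℕ) :
    ∫⁻ ω, ∏ m ∈ Finset.Icc 1 n, (if i ∈ R m ω then g (𝓜.X i m ω) else 1) ∂𝓜.P A = 1 := by
  have hP := 𝓜.isProbabilityMeasure A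
  set Q : ℕ → Ω → ℝ≥0∞ := fun n ω =>
    ∏ m ∈ Finset.Icc 1 n, (if i ∈ R m ω then g (𝓜.X i m ω) else 1) with hQ
  -- On the event that the source is sampled, the new factor is independent of the past and has mean
  -- one; elsewhere the product does not change.
  have hsucc : ∀ n ω, Q (n + 1) ω =
      {ω | i ∈ R (n + 1) ω}.indicator (Q n) ω * g (𝓜.X i (n + 1) ω) +
        {ω | i ∈ R (n + 1) ω}ᶜ.indicator (Q n) ω := by
    intro n ω
    simp only [hQ]
    rw [Finset.prod_Icc_succ_top (by omega)]
    by_cases h : i ∈ R (n + 1) ω <;> simp [h]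
  have hQm : ∀ n, Measurable[𝓜.past n] (Q n) := by
    intro n
    induction n with
    | zero => simp only [hQ, Finset.Icc_eq_empty_of_lt one_pos, Finset.prod_empty]; fun_prop
    | succ n ih =>
      rw [show Q (n + 1) = _ from funext (hsucc n)]
      have hle := 𝓜.past_mono n.le_succ
      exact (((ih.indicator (hR n)).mono hle le_rfl).mul
        (hg.comp (𝓜.measurable_X_past i n))).add ((ih.indicator (hR n).compl).mono hle le_rfl)
  change ∫⁻ ω, Q n ω ∂𝓜.P A = 1
  induction n with
  | zero => simp [hQ]
  | succ n ih =>
    simp only [hsucc]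
    have hm1 := (hQm n).indicator (hR n)
    have hm2 := (hQm n).indicator (hR n).compl
    have hs := 𝓜.past_le n _ (hR n)
    rw [lintegral_add_right _ (hm2.mono (𝓜.past_le n) le_rfl),
      𝓜.lintegral_past_mul_next A i n hm1 hg, hg1, mul_one, lintegral_indicator hs,
      lintegral_indicator hs.compl, lintegral_add_compl _ hs, ih]

theorem measurable_count (i : Fin M)
    (hR : ∀ n, MeasurableSet[𝓜.past n] {ω | i ∈ R (n + 1) ω}) (n : ℕ) :
    Measurable (count R i n) := by
  refine Finset.measurable_sum _ fun m hm => ?_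
  obtain ⟨m, rfl⟩ : ∃ j, m = j + 1 := ⟨m - 1, by have := (Finset.mem_Icc.1 hm).1; omega⟩
  exact Measurable.ite (𝓜.past_le m _ (hR m)) measurable_const measurable_const

theorem measurable_slr_of_predictable (A : Finset (Fin M)) (i : Fin M)
    (hR : ∀ n, MeasurableSet[𝓜.past n] {ω | i ∈ R (n + 1) ω}) (n : ℕ) :
    Measurable (𝓜.slr A R i n) := by
  refine Finset.measurable_sum _ fun m hm => ?_
  obtain ⟨m, rfl⟩ : ∃ j, m = j + 1 := ⟨m - 1, by have := (Finset.mem_Icc.1 hm).1; omega⟩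
  exact Measurable.ite (𝓜.past_le m _ (hR m))
    ((𝓜.measurable_score A i).comp (𝓜.measurable_X i m)) measurable_const

theorem lintegral_exp_neg_slr (A : Finset (Fin M)) (i : Fin M)
    (hR : ∀ n, MeasurableSet[𝓜.past n] {ω | i ∈ R (n + 1) ω}) (n : ℕ) :
    ∫⁻ ω, ENNReal.ofReal (Real.exp (-𝓜.slr A R i n ω)) ∂𝓜.P A = 1 := by
  rw [← lintegral_prod_sampled (𝓜 := 𝓜) A i hR
    (g := fun x => ENNReal.ofReal (Real.exp (-𝓜.score A i x))) (by fun_prop)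
    (𝓜.lintegral_exp_neg_score A i) n]
  refine lintegral_congr fun ω => ?_
  rw [slr, ← Finset.sum_neg_distrib, Real.exp_sum,
    ENNReal.ofReal_prod_of_nonneg fun i _ => (Real.exp_pos _).le]
  refine Finset.prod_congr rfl fun m _ => ?_
  split_ifs <;> simp

theorem integrable_score_X (A : Finset (Fin M)) (i : Fin M) (n : ℕ) :
    Integrable (fun ω => 𝓜.score A i (𝓜.X i (n + 1) ω)) (𝓜.P A) := by
  have h := 𝓜.integrable_score A i
  rw [← 𝓜.map_X A i n] at h
  exact h.comp_measurable (𝓜.measurable_X i n)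

theorem integrable_sampled_score (A : Finset (Fin M)) (i : Fin M)
    (hR : ∀ n, MeasurableSet[𝓜.past n] {ω | i ∈ R (n + 1) ω}) (n : ℕ) :
    Integrable (fun ω => if i ∈ R (n + 1) ω then 𝓜.score A i (𝓜.X i (n + 1) ω) else 0)
      (𝓜.P A) := by
  refine ((integrable_score_X (𝓜 := 𝓜) A i n).indicator (𝓜.past_le n _ (hR n))).congr
    (Eventually.of_forall fun ω => ?_)
  simp [Set.indicator_apply]

theorem integrable_slr (A : Finset (Fin M)) (i : Fin M)
    (hR : ∀ n, MeasurableSet[𝓜.past n] {ω | i ∈ R (n + 1) ω}) (n : ℕ) :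
    Integrable (𝓜.slr A R i n) (𝓜.P A) := by
  refine integrable_finsetSum _ fun m hm => ?_
  obtain ⟨m, rfl⟩ : ∃ j, m = j + 1 := ⟨m - 1, by have := (Finset.mem_Icc.1 hm).1; omega⟩
  exact integrable_sampled_score A i hR m

theorem integrable_sampled_one (A : Finset (Fin M)) (i : Fin M)
    (hR : ∀ n, MeasurableSet[𝓜.past n] {ω | i ∈ R (n + 1) ω}) (n : ℕ) :
    Integrable (fun ω => if i ∈ R (n + 1) ω then (1 : ℝ) else 0) (𝓜.P A) := by
  have hP := 𝓜.isProbabilityMeasure A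
  refine ((integrable_const (1 : ℝ)).indicator (𝓜.past_le n _ (hR n))).congr
    (Eventually.of_forall fun ω => ?_)
  simp [Set.indicator_apply]

theorem integrable_count (A : Finset (Fin M)) (i : Fin M)
    (hR : ∀ n, MeasurableSet[𝓜.past n] {ω | i ∈ R (n + 1) ω}) (n : ℕ) :
    Integrable (count R i n) (𝓜.P A) := by
  refine integrable_finsetSum _ fun m hm => ?_
  obtain ⟨m, rfl⟩ : ∃ j, m = j + 1 := ⟨m - 1, by have := (Finset.mem_Icc.1 hm).1; omega⟩
  exact integrable_sampled_one A i hR m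

/-- Wald's identity for a past-predictable sampling. -/
theorem integral_slr (A : Finset (Fin M)) (i : Fin M)
    (hR : ∀ n, MeasurableSet[𝓜.past n] {ω | i ∈ R (n + 1) ω}) (n : ℕ) :
    ∫ ω, 𝓜.slr A R i n ω ∂𝓜.P A = 𝓜.info A i * ∫ ω, count R i n ω ∂𝓜.P A := by
  have hP := 𝓜.isProbabilityMeasure A
  have hex : ∀ m ∈ Finset.Icc 1 n, ∃ j, m = j + 1 := fun m hm =>
    ⟨m - 1, by have := (Finset.mem_Icc.1 hm).1; omega⟩
  simp only [slr, count]
  rw [integral_finsetSum, integral_finsetSum, Finset.mul_sum]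
  · refine Finset.sum_congr rfl fun m hm => ?_
    obtain ⟨m, rfl⟩ := hex m hm
    have hs := 𝓜.past_le m _ (hR m)
    have hu : Measurable[𝓜.past m] fun ω => if i ∈ R (m + 1) ω then (1 : ℝ) else 0 :=
      Measurable.ite (hR m) measurable_const measurable_const
    -- The decision to sample at time `m + 1` belongs to the past up to `m`, hence is independent of
    -- the observation it reveals.
    have hind : IndepFun (fun ω => if i ∈ R (m + 1) ω then (1 : ℝ) else 0)
        (fun ω => 𝓜.score A i (𝓜.X i (m + 1) ω)) (𝓜.P A) := by
      rw [IndepFun_iff_Indep]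
      refine indep_of_indep_of_le_left (indep_of_indep_of_le_right
        (indep_iSup_of_disjoint 𝓜.varSigma_le (𝓜.iIndep_varSigma A)
          (disjoint_pastIdx_range_nextIdx m)) ?_) hu.comap_le
      have hle : 𝓜.varSigma (nextIdx M m (Sum.inl i)) ≤
        ⨆ q ∈ Set.range (nextIdx M m), 𝓜.varSigma q :=
        le_iSup₂_of_le (nextIdx M m (Sum.inl i)) ⟨_, rfl⟩ le_rfl
      exact (((𝓜.measurable_score A i).comp (comap_measurable _)).mono hle le_rfl).comap_le
    have hX : ∫ ω, 𝓜.score A i (𝓜.X i (m + 1) ω) ∂𝓜.P A = 𝓜.info A i := by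
      rw [← 𝓜.integral_score A i, ← 𝓜.map_X A i m,
        integral_map (𝓜.measurable_X i m).aemeasurable
          (𝓜.measurable_score A i).aestronglyMeasurable]
    have := hind.integral_mul_eq_mul_integral
      (hu.mono (𝓜.past_le m) le_rfl).aestronglyMeasurable
      (integrable_score_X (𝓜 := 𝓜) A i m).aestronglyMeasurable
    rw [hX] at this
    rw [mul_comm (𝓜.info A i), ← this]
    refine integral_congr_ae (Eventually.of_forall fun ω => ?_)
    by_cases h : i ∈ R (m + 1) ω <;> simp [h]
  · intro m hm
    obtain ⟨m, rfl⟩ := hex m hm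
    exact integrable_sampled_one A i hR m
  · intro m hm
    obtain ⟨m, rfl⟩ := hex m hm
    exact integrable_sampled_score A i hR m

/-- Normalizes the Chernoff factor `ψ < 1` by `t = -log ψ > 0`, so that `lintegral_prod_sampled`
applies. The gain `t` per sampled observation produces the exponential decay. -/
theorem exists_lintegral_exp_score_add_eq_one (𝓜 : Model M S Ω) (A : Finset (Fin M)) (i : Fin M)
    {a : ℝ} (ha : a < 𝓜.info A i) :
    ∃ θ t : ℝ, 0 < θ ∧ 0 < t ∧
      ∫⁻ x, ENNReal.ofReal (Real.exp (-θ * (𝓜.score A i x - a) + t)) ∂𝓜.law A i = 1 := by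
  have hP := 𝓜.isProbabilityMeasure_law A i
  obtain ⟨θ, hθ, h⟩ := 𝓜.exists_lintegral_exp_neg_score_lt_one A i ha
  set ψ := ∫⁻ x, ENNReal.ofReal (Real.exp (-θ * (𝓜.score A i x - a))) ∂𝓜.law A i with hψ
  have h0 : ψ ≠ 0 := by
    intro h0
    rw [hψ, lintegral_eq_zero_iff (by fun_prop)] at h0
    obtain ⟨x, hx⟩ := h0.exists
    exact absurd hx (by simp [Real.exp_pos])
  have hp : 0 < ψ.toReal := ENNReal.toReal_pos h0 (h.trans ENNReal.one_lt_top).ne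
  have h1 : ψ.toReal < 1 := by
    simpa using (ENNReal.toReal_lt_toReal (h.trans ENNReal.one_lt_top).ne ENNReal.one_ne_top).2 h
  refine ⟨θ, -Real.log ψ.toReal, hθ, neg_pos.2 (Real.log_neg hp h1), ?_⟩
  have : ∀ x, ENNReal.ofReal (Real.exp (-θ * (𝓜.score A i x - a) + -Real.log ψ.toReal)) =
      ψ⁻¹ * ENNReal.ofReal (Real.exp (-θ * (𝓜.score A i x - a))) := fun x => by
    rw [Real.exp_add, mul_comm, ENNReal.ofReal_mul (Real.exp_pos _).le, Real.exp_neg (Real.log _),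
      Real.exp_log hp, ENNReal.ofReal_inv_of_pos hp,
      ENNReal.ofReal_toReal (h.trans ENNReal.one_lt_top).ne]
  simp only [this]
  rw [lintegral_const_mul _ (by fun_prop), ← hψ,
    ENNReal.inv_mul_cancel h0 (h.trans ENNReal.one_lt_top).ne]

/-- Exponential decay of the lower deviations of a log-likelihood ratio on the event that the
source has been sampled a positive proportion of time. -/
theorem exists_measure_slr_le_exp (A : Finset (Fin M)) (i : Fin M)
    (hR : ∀ n, MeasurableSet[𝓜.past n] {ω | i ∈ R (n + 1) ω}) {ρ a : ℝ} (hρ : 0 < ρ)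
    (ha : a < 𝓜.info A i) :
    ∃ b : ℝ, 0 < b ∧ ∀ n : ℕ,
      (𝓜.P A).real {ω | ρ * n ≤ count R i n ω ∧ 𝓜.slr A R i n ω ≤ a * count R i n ω} ≤
        Real.exp (-(b * n)) := by
  have hP := 𝓜.isProbabilityMeasure A
  obtain ⟨θ, t, hθ, ht, h1⟩ := exists_lintegral_exp_score_add_eq_one 𝓜 A i ha
  refine ⟨t * ρ, by positivity, fun n => ?_⟩
  have hint := lintegral_prod_sampled (𝓜 := 𝓜) A i hR (by fun_prop) h1 n
  have hprod : ∀ ω, ∏ m ∈ Finset.Icc 1 n, (if i ∈ R m ω then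
      ENNReal.ofReal (Real.exp (-θ * (𝓜.score A i (𝓜.X i m ω) - a) + t)) else 1) =
      ENNReal.ofReal (Real.exp (-θ * (𝓜.slr A R i n ω - a * count R i n ω) +
        t * count R i n ω)) := by
    intro ω
    have : -θ * (𝓜.slr A R i n ω - a * count R i n ω) + t * count R i n ω =
        ∑ m ∈ Finset.Icc 1 n,
          if i ∈ R m ω then -θ * (𝓜.score A i (𝓜.X i m ω) - a) + t else 0 := by
      simp only [slr, count, Finset.mul_sum, ← Finset.sum_sub_distrib, ← Finset.sum_add_distrib]
      refine Finset.sum_congr rfl fun m _ => ?_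
      split_ifs <;> ring
    rw [this, Real.exp_sum, ENNReal.ofReal_prod_of_nonneg fun i _ => (Real.exp_pos _).le]
    refine Finset.prod_congr rfl fun m _ => ?_
    split_ifs <;> simp
  simp only [hprod] at hint
  have hmeas : Measurable fun ω => ENNReal.ofReal (Real.exp
      (-θ * (𝓜.slr A R i n ω - a * count R i n ω) + t * count R i n ω)) := by
    have := measurable_count i hR n
    have := measurable_slr_of_predictable A i hR n
    fun_prop
  -- Markov's inequality for a variable of mean one: on the event in question the `θ` term is
  -- nonnegative and the count is at least `ρ * n`, so the exponent is at least `t * ρ * n`.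
  have hmarkov := mul_meas_ge_le_lintegral (μ := 𝓜.P A) hmeas
    (ENNReal.ofReal (Real.exp (t * ρ * n)))
  rw [hint] at hmarkov
  have hsub : 𝓜.P A {ω | ρ * n ≤ count R i n ω ∧ 𝓜.slr A R i n ω ≤ a * count R i n ω} ≤
      𝓜.P A {ω | ENNReal.ofReal (Real.exp (t * ρ * n)) ≤ ENNReal.ofReal (Real.exp
        (-θ * (𝓜.slr A R i n ω - a * count R i n ω) + t * count R i n ω))} := by
    refine measure_mono fun ω hω => ENNReal.ofReal_le_ofReal (Real.exp_le_exp.2 ?_)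
    have h2 : 0 ≤ θ * (a * count R i n ω - 𝓜.slr A R i n ω) :=
      mul_nonneg hθ.le (sub_nonneg.2 hω.2)
    have h3 := mul_le_mul_of_nonneg_left hω.1 ht.le
    linarith
  have hfin := (mul_le_mul_right hsub (ENNReal.ofReal (Real.exp (t * ρ * n)))).trans hmarkov
  have := ENNReal.toReal_mono ENNReal.one_ne_top hfin
  rw [ENNReal.toReal_mul, ENNReal.toReal_ofReal (Real.exp_pos _).le, ENNReal.toReal_one] at this
  rw [Real.exp_neg, ← one_div, le_div_iff₀' (Real.exp_pos _)]
  exact this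

end Model

/-! ### Sums of the smallest values -/

/-- Exchange argument: the initial segment and `V` differ by sets of equal size, and every index
lost from the segment precedes every index gained. -/
theorem sum_initial_le_sum_of_monotone {M k : ℕ} {y : Fin M → ℝ} (hy : Monotone y)
    {V : Finset (Fin M)} (hV : V.card = k) (hkM : k ≤ M) :
    ∑ i : Fin M with i.val < k, y i ≤ ∑ i ∈ V, y i := by
  classical
  set L : Finset (Fin M) := Finset.univ.filter fun i => i.val < k with hL
  have hLc : L.card = k := by rw [hL, Fin.card_filter_val_lt, min_eq_right hkM]
  have hcard : (L \ V).card = (V \ L).card :=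
    Finset.card_sdiff_comm (hLc.trans hV.symm)
  have hmain : ∑ i ∈ L \ V, y i ≤ ∑ i ∈ V \ L, y i := by
    rcases (L \ V).eq_empty_or_nonempty with h | h
    · rw [h, Finset.card_empty] at hcard
      rw [h, Finset.card_eq_zero.1 hcard.symm]
    · obtain ⟨i₀, hi₀, hmax⟩ := Finset.exists_max_image (L \ V) y h
      calc ∑ i ∈ L \ V, y i ≤ (L \ V).card • y i₀ := Finset.sum_le_card_nsmul _ _ _ hmax
        _ = (V \ L).card • y i₀ := by rw [hcard]
        _ ≤ _ := by
          refine Finset.card_nsmul_le_sum _ _ _ fun j hj => hy ?_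
          have h1 : i₀.val < k := by
            have := (Finset.mem_sdiff.1 hi₀).1
            simpa [hL] using this
          have h2 : k ≤ j.val := by
            have := (Finset.mem_sdiff.1 hj).2
            simpa [hL] using this
          exact Fin.le_def.2 (by omega)
  rw [← Finset.sum_inter_add_sum_sdiff L V, ← Finset.sum_inter_add_sum_sdiff V L,
    Finset.inter_comm V L]
  linarith

theorem sum_initial_sort_le {M k : ℕ} (x : Fin M → ℝ) {U : Finset (Fin M)} (hU : U.card = k)
    (hkM : k ≤ M) : ∑ i : Fin M with i.val < k, (x ∘ Tuple.sort x) i ≤ ∑ i ∈ U, x i := by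
  have h := sum_initial_le_sum_of_monotone (Tuple.monotone_sort x)
    (V := U.map (Tuple.sort x).symm.toEmbedding) (by simpa using hU) hkM
  simpa using h

theorem exists_sum_initial_sort_eq {M k : ℕ} (x : Fin M → ℝ) (hkM : k ≤ M) :
    ∃ U : Finset (Fin M), U.card = k ∧
      ∑ i : Fin M with i.val < k, (x ∘ Tuple.sort x) i = ∑ i ∈ U, x i := by
  refine ⟨(Finset.univ.filter fun i : Fin M => i.val < k).map (Tuple.sort x).toEmbedding, ?_, ?_⟩
  · rw [Finset.card_map, Fin.card_filter_val_lt, min_eq_right hkM]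
  · simp

/-- Replaces order statistics by a condition on all `k`-subsets, the form in which the stopping rule
is used from here on. -/
theorem le_sum_initial_sort_iff {M k : ℕ} (x : Fin M → ℝ) (hkM : k ≤ M) (d : ℝ) :
    d ≤ ∑ i : Fin M with i.val < k, (x ∘ Tuple.sort x) i ↔
      ∀ U : Finset (Fin M), U.card = k → d ≤ ∑ i ∈ U, x i := by
  refine ⟨fun h U hU => h.trans (sum_initial_sort_le x hU hkM), fun h => ?_⟩
  obtain ⟨U, hU, he⟩ := exists_sum_initial_sort_eq x hkM
  exact he ▸ h U hU

namespace Model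

variable {M : ℕ} {S Ω : Type*} [MeasurableSpace S] [MeasurableSpace Ω] {𝓜 : Model M S Ω}
  {R : ℕ → Ω → Finset (Fin M)}

/-! ### The sum-intersection rule is a policy with controlled error probability -/

variable (𝓜) in
/-- The sum-intersection rule may stop at time `n`. -/
def SiCross (R : ℕ → Ω → Finset (Fin M)) (k : ℕ) (d : ℝ) (n : ℕ) (ω : Ω) : Prop :=
  ∀ U : Finset (Fin M), U.card = k → d ≤ ∑ i ∈ U, |𝓜.llr R i n ω|

theorem siTime_eq_sInf {k : ℕ} (hkM : k ≤ M) (d : ℝ) (ω : Ω) :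
    𝓜.siTime R k d ω =
      sInf ((fun n : ℕ => (n : ℕ∞)) '' {n : ℕ | 1 ≤ n ∧ 𝓜.SiCross R k d n ω}) := by
  unfold siTime sortedAbsLLR SiCross
  simp only [le_sum_initial_sort_iff _ hkM]

theorem siTime_le {k : ℕ} (hkM : k ≤ M) {d : ℝ} {ω : Ω} {n : ℕ} (hn : 1 ≤ n)
    (h : 𝓜.SiCross R k d n ω) : 𝓜.siTime R k d ω ≤ n := by
  rw [siTime_eq_sInf hkM]
  exact sInf_le ⟨n, ⟨hn, h⟩, rfl⟩

theorem siTime_eq_coe_iff {k : ℕ} (hkM : k ≤ M) (d : ℝ) (ω : Ω) (n : ℕ) :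
    𝓜.siTime R k d ω = n ↔
      (1 ≤ n ∧ 𝓜.SiCross R k d n ω) ∧ ∀ m < n, 1 ≤ m → ¬ 𝓜.SiCross R k d m ω := by
  constructor
  · intro h
    have hne : ((fun n : ℕ => (n : ℕ∞)) '' {n : ℕ | 1 ≤ n ∧ 𝓜.SiCross R k d n ω}).Nonempty := by
      by_contra hcon
      rw [Set.not_nonempty_iff_eq_empty] at hcon
      rw [siTime_eq_sInf hkM, hcon, sInf_empty] at h
      exact absurd h.symm (ENat.natCast_ne_top n)
    refine ⟨?_, fun m hm h1 hc => ?_⟩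
    -- A nonempty subset of `ℕ∞` attains its infimum.
    · obtain ⟨m, hm, he⟩ := csInf_mem hne
      rw [← siTime_eq_sInf hkM, h] at he
      have : m = n := by simpa using he
      exact this ▸ hm
    · have := siTime_le hkM h1 hc
      rw [h] at this
      have : n ≤ m := by exact_mod_cast this
      omega
  · rintro ⟨⟨h1, h2⟩, h3⟩
    refine le_antisymm (siTime_le hkM h1 h2) ?_
    rw [siTime_eq_sInf hkM]
    refine le_sInf ?_
    rintro _ ⟨m, ⟨hm1, hm2⟩, rfl⟩
    by_contra hcon
    exact h3 m (by simpa using hcon) hm1 hm2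

theorem one_le_siTime {k : ℕ} (hkM : k ≤ M) (d : ℝ) (ω : Ω) : 1 ≤ 𝓜.siTime R k d ω := by
  rw [siTime_eq_sInf hkM]
  refine le_sInf ?_
  rintro _ ⟨m, ⟨hm1, -⟩, rfl⟩
  simpa using hm1

theorem IsSamplingRule.measurableSet_siCross (hR : 𝓜.IsSamplingRule R) (k : ℕ) (d : ℝ) (n : ℕ) :
    MeasurableSet[𝓜.filt R n] {ω | 𝓜.SiCross R k d n ω} := by
  simp only [SiCross, Set.ofPred_forall]
  refine MeasurableSet.iInter fun U => MeasurableSet.iInter fun _ => ?_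
  have h : Measurable[𝓜.filt R n] fun ω => ∑ i ∈ U, |𝓜.llr R i n ω| :=
    U.measurable_sum fun i _ => measurable_abs.comp (hR.measurable_llr i n)
  exact h measurableSet_Ici

theorem IsSamplingRule.measurableSet_siTime (hR : 𝓜.IsSamplingRule R) {k : ℕ} (hkM : k ≤ M)
    (d : ℝ) (n : ℕ) : MeasurableSet[𝓜.filt R n] {ω | 𝓜.siTime R k d ω = n} := by
  have : {ω | 𝓜.siTime R k d ω = n} = ({ω | 1 ≤ n} ∩ {ω | 𝓜.SiCross R k d n ω}) ∩
      ⋂ m, ⋂ (_ : m < n), ⋂ (_ : 1 ≤ m), {ω | 𝓜.SiCross R k d m ω}ᶜ := by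
    ext ω
    simp [siTime_eq_coe_iff hkM]
  rw [this]
  refine ((MeasurableSet.const _).inter (hR.measurableSet_siCross k d n)).inter
    (MeasurableSet.iInter fun m => MeasurableSet.iInter fun hm => MeasurableSet.iInter fun _ => ?_)
  exact filt_mono 𝓜 R hm.le _ (hR.measurableSet_siCross k d m).compl

theorem IsSamplingRule.measurableSet_siTime_siDecision (hR : 𝓜.IsSamplingRule R) {k : ℕ}
    (hkM : k ≤ M) (d : ℝ) (n : ℕ) (p : Finset (Fin M) → Prop) :
    MeasurableSet[𝓜.filt R n] {ω | 𝓜.siTime R k d ω = n ∧ p (𝓜.siDecision R k d ω)} := by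
  classical
  have : {ω | 𝓜.siTime R k d ω = n ∧ p (𝓜.siDecision R k d ω)} =
      ⋃ D ∈ {D | p D}, ({ω | 𝓜.siTime R k d ω = n} ∩
        ⋂ i, {ω | 0 < 𝓜.llr R i n ω ↔ i ∈ D}) := by
    ext ω
    simp only [Set.mem_ofPred_eq, Set.mem_iUnion, Set.mem_inter_iff, Set.mem_iInter, exists_prop]
    constructor
    · rintro ⟨h1, h2⟩
      exact ⟨_, h2, h1, fun i => by simp [siDecision, h1]⟩
    · rintro ⟨D, hD, h1, h2⟩
      have : 𝓜.siDecision R k d ω = D := by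
        ext i
        simp [siDecision, h1, h2]
      exact ⟨h1, this ▸ hD⟩
  rw [this]
  refine MeasurableSet.biUnion (Set.to_countable _) fun D _ =>
    (hR.measurableSet_siTime hkM d n).inter (MeasurableSet.iInter fun i => ?_)
  have hm : MeasurableSet[𝓜.filt R n] {ω | 0 < 𝓜.llr R i n ω} :=
    hR.measurable_llr i n measurableSet_Ioi
  by_cases hi : i ∈ D
  · simpa [hi] using hm
  · simp only [hi, iff_false]
    exact hm.compl

theorem IsSamplingRule.isPolicy_siPolicy (hR : 𝓜.IsSamplingRule R) {k : ℕ} (hkM : k ≤ M)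
    (d : ℝ) : 𝓜.IsPolicy (𝓜.siPolicy R k d) :=
  ⟨hR, fun ω => one_le_siTime hkM d ω, fun n _ => hR.measurableSet_siTime hkM d n,
    fun n _ D => hR.measurableSet_siTime_siDecision hkM d n fun D' => D' = D⟩

/-- The probability that the sum-intersection rule errs in all the sources of a given set. -/
theorem IsSamplingRule.measure_siDecision_error_le (hR : 𝓜.IsSamplingRule R) {k : ℕ}
    (hkM : k ≤ M) (d : ℝ) (B U : Finset (Fin M)) (hU : U.card = k) :
    𝓜.P B {ω | 𝓜.siTime R k d ω ≠ ⊤ ∧ U ⊆ symmDiff B (𝓜.siDecision R k d ω)} ≤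
      ENNReal.ofReal (Real.exp (-d)) := by
  have hP := 𝓜.isProbabilityMeasure (symmDiff B U)
  set E : ℕ → Set Ω := fun n =>
    {ω | 𝓜.siTime R k d ω = n ∧ U ⊆ symmDiff B (𝓜.siDecision R k d ω)} with hE
  have hEm : ∀ n, MeasurableSet[𝓜.filt R n] (E n) := fun n =>
    hR.measurableSet_siTime_siDecision hkM d n fun D => U ⊆ symmDiff B D
  have hunion : {ω | 𝓜.siTime R k d ω ≠ ⊤ ∧ U ⊆ symmDiff B (𝓜.siDecision R k d ω)} =
      ⋃ n, E n := by
    ext ω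
    simp only [hE, Set.mem_ofPred_eq, Set.mem_iUnion, exists_and_right, ENat.ne_top_iff_exists]
    simp [eq_comm]
  have hdisj : Pairwise (Function.onFun Disjoint E) := by
    intro m n hmn
    refine Set.disjoint_left.2 fun ω h1 h2 => hmn ?_
    have := h1.1.symm.trans h2.1
    exact_mod_cast this
  -- An error in source `i` means that its log-likelihood ratio, oriented in favour of `B`, is
  -- `-|llr|`. The exponent of the likelihood ratio is thus the sum of `|llr|` over `U`, which the
  -- stopping condition bounds below by `d`.
  have hlr : ∀ n, ∀ ω ∈ E n, ENNReal.ofReal (Real.exp d) ≤ 𝓜.lr B U R n ω := by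
    intro n ω hω
    refine ENNReal.ofReal_le_ofReal (Real.exp_le_exp.2 ?_)
    have hc := ((siTime_eq_coe_iff hkM d ω n).1 hω.1).1.2 U hU
    rw [← Finset.sum_neg_distrib]
    refine hc.trans (Finset.sum_le_sum fun i hi => ?_)
    have hi' := hω.2 hi
    rw [Finset.mem_symmDiff] at hi'
    rw [slr_eq]
    have hdec : i ∈ 𝓜.siDecision R k d ω ↔ 0 < 𝓜.llr R i n ω := by simp [siDecision, hω.1]
    rw [hdec] at hi'
    rcases hi' with ⟨h1, h2⟩ | ⟨h1, h2⟩
    · rw [if_pos h1, abs_of_nonpos (not_lt.1 h2)]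
    · rw [if_neg h2, neg_neg, abs_of_pos h1]
  have hbound : ∀ n, 𝓜.P B (E n) ≤
      ENNReal.ofReal (Real.exp (-d)) * 𝓜.P (symmDiff B U) (E n) := by
    intro n
    have h1 : ENNReal.ofReal (Real.exp d) * 𝓜.P B (E n) ≤ 𝓜.P (symmDiff B U) (E n) := by
      rw [← hR.setLIntegral_lr B U n (hEm n), ← setLIntegral_const]
      exact setLIntegral_mono' (hR.filt_le n _ (hEm n)) (hlr n)
    calc 𝓜.P B (E n) = ENNReal.ofReal (Real.exp (-d)) *
          (ENNReal.ofReal (Real.exp d) * 𝓜.P B (E n)) := by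
          rw [← mul_assoc, ← ENNReal.ofReal_mul (Real.exp_pos _).le, ← Real.exp_add]
          simp
      _ ≤ _ := by gcongr
  rw [hunion]
  calc 𝓜.P B (⋃ n, E n) ≤ ∑' n, 𝓜.P B (E n) := measure_iUnion_le _
    _ ≤ ∑' n, ENNReal.ofReal (Real.exp (-d)) * 𝓜.P (symmDiff B U) (E n) :=
        ENNReal.tsum_le_tsum hbound
    _ = ENNReal.ofReal (Real.exp (-d)) * 𝓜.P (symmDiff B U) (⋃ n, E n) := by
        rw [ENNReal.tsum_mul_left, measure_iUnion hdisj fun n => hR.filt_le n _ (hEm n)]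
    _ ≤ ENNReal.ofReal (Real.exp (-d)) * 1 := by gcongr; exact prob_le_one
    _ = _ := mul_one _

/-- At least `k` errors means that some `k`-subset is entirely wrong. The term `log (M.choose k)` in
the threshold pays exactly for the union bound. -/
theorem IsSamplingRule.errorConstraint_siPolicy (hR : 𝓜.IsSamplingRule R) {k : ℕ}
    (hkM : k ≤ M) {α : ℝ} (h0 : 0 < α) (h1 : α < 1) :
    𝓜.ErrorConstraint α k (𝓜.siPolicy R k (threshold M k α)) := by
  classical
  intro B
  set d := threshold M k α
  have hsub : {ω | (𝓜.siPolicy R k d).T ω ≠ ⊤ ∧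
      k ≤ (symmDiff B ((𝓜.siPolicy R k d).Δ ω)).card} ⊆
      ⋃ U ∈ Finset.powersetCard k (Finset.univ : Finset (Fin M)),
        {ω | 𝓜.siTime R k d ω ≠ ⊤ ∧ U ⊆ symmDiff B (𝓜.siDecision R k d ω)} := by
    rintro ω ⟨hT, hc⟩
    obtain ⟨U, hU, hUc⟩ := Finset.exists_subset_card_eq hc
    simp only [Set.mem_iUnion, Finset.mem_powersetCard, exists_prop]
    exact ⟨U, ⟨Finset.subset_univ _, hUc⟩, hT, hU⟩
  refine (measure_mono hsub).trans ((measure_biUnion_finset_le _ _).trans ?_)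
  calc ∑ U ∈ Finset.powersetCard k (Finset.univ : Finset (Fin M)),
        𝓜.P B {ω | 𝓜.siTime R k d ω ≠ ⊤ ∧ U ⊆ symmDiff B (𝓜.siDecision R k d ω)}
      ≤ ∑ U ∈ Finset.powersetCard k (Finset.univ : Finset (Fin M)),
        ENNReal.ofReal (Real.exp (-d)) := Finset.sum_le_sum fun U hU =>
          hR.measure_siDecision_error_le hkM d B U (Finset.mem_powersetCard.1 hU).2
    _ = ENNReal.ofReal ((M.choose k : ℝ) * Real.exp (-d)) := by
        rw [Finset.sum_const, Finset.card_powersetCard, Finset.card_univ, Fintype.card_fin,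
          nsmul_eq_mul, ENNReal.ofReal_mul (Nat.cast_nonneg _), ENNReal.ofReal_natCast]
    _ ≤ ENNReal.ofReal α := by
        refine ENNReal.ofReal_le_ofReal (le_of_eq ?_)
        have hc : (0 : ℝ) < M.choose k := by exact_mod_cast Nat.choose_pos hkM
        simp only [d, threshold]
        rw [abs_of_neg (Real.log_neg h0 h1), neg_add, neg_neg, Real.exp_add, Real.exp_neg,
          Real.exp_log h0, Real.exp_log hc]
        field_simp

end Model

/-! ### The allocation problem -/

theorem minSum_le {M k : ℕ} (L c : Fin M → ℝ) {U : Finset (Fin M)} (hU : U.card = k) :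
    minSum k L c ≤ ∑ i ∈ U, c i * L i :=
  ciInf_le (Set.finite_range _).bddBelow (⟨U, hU⟩ : {U : Finset (Fin M) // U.card = k})

theorem exists_minSum_eq {M k : ℕ} (hkM : k ≤ M) (L c : Fin M → ℝ) :
    ∃ U : Finset (Fin M), U.card = k ∧ minSum k L c = ∑ i ∈ U, c i * L i := by
  obtain ⟨U₀, -, hU₀⟩ := Finset.exists_subset_card_eq
    (s := (Finset.univ : Finset (Fin M))) (n := k) (by simpa using hkM)
  have : Nonempty {U : Finset (Fin M) // U.card = k} := ⟨⟨U₀, hU₀⟩⟩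
  obtain ⟨U, hU⟩ := exists_eq_ciInf_of_finite
    (f := fun U : {U : Finset (Fin M) // U.card = k} => ∑ i ∈ U.1, c i * L i)
  exact ⟨U.1, U.2, hU.symm⟩

theorem IsMaximizer.optValue_eq {M k : ℕ} {K : ℝ} {L c : Fin M → ℝ} (h : IsMaximizer k K L c) :
    optValue k K L = minSum k L c := by
  refine IsGreatest.csSup_eq ⟨⟨c, h.1, rfl⟩, ?_⟩
  rintro _ ⟨b, hb, rfl⟩
  exact h.2 b hb

theorem IsMaximizer.minSum_le_optValue {M k : ℕ} {K : ℝ} {L c b : Fin M → ℝ}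
    (h : IsMaximizer k K L c) (hb : b ∈ allocSet M K) : minSum k L b ≤ optValue k K L :=
  h.optValue_eq ▸ h.2 b hb

theorem IsMaximizer.optValue_pos {M k : ℕ} {K : ℝ} {L c : Fin M → ℝ}
    (h : IsMaximizer k K L c) (hk : 1 ≤ k) (hkM : k ≤ M) (hK : 0 < K) (hKM : K ≤ M)
    (hL : ∀ i, 0 < L i) : 0 < optValue k K L := by
  have hM : (0 : ℝ) < M := by exact_mod_cast (by omega : 0 < M)
  -- The uniform allocation is feasible because `K ≤ M`, and it gives positive information to every
  -- source.
  have hb : (fun _ : Fin M => K / M) ∈ allocSet M K := by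
    refine ⟨fun i => ⟨by positivity, (div_le_one hM).2 hKM⟩, ?_⟩
    simp only [Finset.sum_const, Finset.card_univ, Fintype.card_fin, nsmul_eq_mul]
    rw [mul_div_cancel₀ _ hM.ne']
  refine lt_of_lt_of_le ?_ (h.minSum_le_optValue hb)
  obtain ⟨U, hU, he⟩ := exists_minSum_eq hkM L fun _ => K / M
  rw [he]
  refine Finset.sum_pos (fun i _ => mul_pos (by positivity) (hL i)) ?_
  rw [← Finset.card_pos]; omega

/-! ### Stopped sampling rules -/

namespace Model

variable {M : ℕ} {Ω : Type*} {R : ℕ → Ω → Finset (Fin M)}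

/-- A sampling rule which is switched off after the time `T`. -/
def stopped (R : ℕ → Ω → Finset (Fin M)) (T : Ω → ℕ∞) (m : ℕ) (ω : Ω) : Finset (Fin M) :=
  if (m : ℕ∞) ≤ T ω then R m ω else ∅

theorem sum_stopped {T : Ω → ℕ∞} {ω : Ω} {n N : ℕ} (hT : T ω = n) (hn : n ≤ N) (i : Fin M)
    (f : ℕ → ℝ) : ∑ m ∈ Finset.Icc 1 N, (if i ∈ stopped R T m ω then f m else 0) =
      ∑ m ∈ Finset.Icc 1 n, if i ∈ R m ω then f m else 0 := by
  have hsub : Finset.Icc 1 n ⊆ Finset.Icc 1 N := Finset.Icc_subset_Icc_right hn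
  rw [← Finset.sum_subset hsub]
  · refine Finset.sum_congr rfl fun m hm => ?_
    have : (m : ℕ∞) ≤ T ω := by
      rw [hT]; exact_mod_cast (Finset.mem_Icc.1 hm).2
    simp [stopped, this]
  · intro m hm hm'
    have : ¬ (m : ℕ∞) ≤ T ω := by
      rw [hT]
      intro h
      have h' : m ≤ n := by exact_mod_cast h
      exact hm' (Finset.mem_Icc.2 ⟨(Finset.mem_Icc.1 hm).1, h'⟩)
    simp [stopped, this]

theorem count_nonneg (i : Fin M) (n : ℕ) (ω : Ω) : 0 ≤ count R i n ω :=
  Finset.sum_nonneg fun m _ => by split_ifs <;> norm_num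

theorem count_le (i : Fin M) (n : ℕ) (ω : Ω) : count R i n ω ≤ n := by
  calc count R i n ω ≤ ∑ m ∈ Finset.Icc 1 n, (1 : ℝ) :=
        Finset.sum_le_sum fun m _ => by split_ifs <;> norm_num
    _ = n := by simp

theorem count_mono (i : Fin M) (ω : Ω) : Monotone fun n => count R i n ω := by
  intro m n hmn
  exact Finset.sum_le_sum_of_subset_of_nonneg (Finset.Icc_subset_Icc_right hmn)
    fun m _ _ => by split_ifs <;> norm_num

theorem sum_count (n : ℕ) (ω : Ω) :
    ∑ i, count R i n ω = ∑ m ∈ Finset.Icc 1 n, ((R m ω).card : ℝ) := by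
  simp only [count]
  rw [Finset.sum_comm]
  refine Finset.sum_congr rfl fun m _ => ?_
  simp

theorem count_stopped_le {T : Ω → ℕ∞} {ω : Ω} {n : ℕ} (hT : T ω = n) (i : Fin M) (N : ℕ) :
    count (stopped R T) i N ω ≤ count R i n ω := by
  have h : count (stopped R T) i (max n N) ω = count R i n ω :=
    sum_stopped hT (le_max_left n N) i fun _ => 1
  exact h ▸ count_mono i ω (le_max_right n N)

end Model

/-! ### The universal lower bound -/

namespace Model

variable {M : ℕ} {S Ω : Type*} [MeasurableSpace S] [MeasurableSpace Ω] {𝓜 : Model M S Ω}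
  {R : ℕ → Ω → Finset (Fin M)}

/-- The feasible set is invariant under permutations, so an allocation indexed by sources may be
compared with the value of the sorted problem. The set `U` depends on `c`. -/
theorem exists_sum_mul_info_le_optValue {k : ℕ} {K : ℝ} {A : Finset (Fin M)} {c' : Fin M → ℝ}
    (h : IsMaximizer k K (𝓜.F A) c') (hkM : k ≤ M) {c : Fin M → ℝ} (hc : c ∈ allocSet M K) :
    ∃ U : Finset (Fin M), U.card = k ∧
      ∑ i ∈ U, c i * 𝓜.info A i ≤ optValue k K (𝓜.F A) := by
  set s := Tuple.sort (𝓜.info A)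
  have hb : c ∘ s ∈ allocSet M K :=
    ⟨fun i => hc.1 (s i), (Equiv.sum_comp s c).trans_le hc.2⟩
  obtain ⟨U, hU, he⟩ := exists_minSum_eq hkM (𝓜.F A) (c ∘ s)
  refine ⟨U.map s.toEmbedding, by simpa using hU, ?_⟩
  refine le_of_eq_of_le ?_ (h.minSum_le_optValue hb)
  rw [he]
  simp [F, s]

theorem slr_stopped (A : Finset (Fin M)) {T : Ω → ℕ∞} {ω : Ω} {n N : ℕ} (hT : T ω = n)
    (hn : n ≤ N) (i : Fin M) : 𝓜.slr A (stopped R T) i N ω = 𝓜.slr A R i n ω :=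
  sum_stopped hT hn i _

theorem IsPolicy.measurableSet_lt {p : Triplet M Ω} (hp : 𝓜.IsPolicy p) (n : ℕ) :
    MeasurableSet[𝓜.filt p.R n] {ω | ((n + 1 : ℕ) : ℕ∞) ≤ p.T ω} := by
  have : {ω | ((n + 1 : ℕ) : ℕ∞) ≤ p.T ω} =
      (⋃ m ∈ Finset.Icc 1 n, {ω | p.T ω = m})ᶜ := by
    ext ω
    simp only [Set.mem_compl_iff, Set.mem_iUnion, Set.mem_ofPred_eq, exists_prop, Finset.mem_Icc]
    constructor
    · rintro h ⟨m, hm, he⟩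
      rw [he] at h
      have : n + 1 ≤ m := by exact_mod_cast h
      omega
    · intro h
      by_contra hcon
      have h1 := hp.2.1 ω
      obtain ⟨m, hm⟩ := ENat.ne_top_iff_exists.1 (ne_top_of_lt (not_le.1 hcon))
      rw [← hm] at hcon h1
      have h1' : 1 ≤ m := by exact_mod_cast h1
      have h2' : ¬ n + 1 ≤ m := by exact_mod_cast hcon
      exact h ⟨m, ⟨h1', by omega⟩, hm.symm⟩
  rw [this]
  refine (Finset.measurableSet_biUnion _ fun m hm => ?_).compl
  exact filt_mono 𝓜 p.R (Finset.mem_Icc.1 hm).2 _ (hp.2.2.1 m (Finset.mem_Icc.1 hm).1)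

/-- Predictability is stated for the full past rather than for the filtration of the stopped rule.
The martingale identities then apply to it without comparing filtrations of two rules. -/
theorem IsPolicy.predictable_stopped {p : Triplet M Ω} (hp : 𝓜.IsPolicy p) (i : Fin M) (n : ℕ) :
    MeasurableSet[𝓜.past n] {ω | i ∈ stopped p.R p.T (n + 1) ω} := by
  have : {ω | i ∈ stopped p.R p.T (n + 1) ω} =
      {ω | ((n + 1 : ℕ) : ℕ∞) ≤ p.T ω} ∩ {ω | i ∈ p.R (n + 1) ω} := by
    ext ω
    by_cases h : ((n + 1 : ℕ) : ℕ∞) ≤ p.T ω <;> simp [stopped, -Nat.cast_add, h]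
  rw [this]
  exact hp.1.filt_le_past n _ ((hp.measurableSet_lt n).inter
    (hp.1.measurableSet_mem n fun D => i ∈ D))

/-- This is `log y ≤ y - 1` at `y = exp (-x) / α`. Being linear in `x`, it can be integrated
directly: Wald's identity handles `x`, and a change of measure handles the exponential. -/
theorem neg_log_le_add_exp_div {α : ℝ} (hα : 0 < α) (x : ℝ) :
    -Real.log α ≤ x + Real.exp (-x) / α := by
  have h := Real.log_le_sub_one_of_pos (show 0 < Real.exp (-x) / α by positivity)
  rw [Real.log_div (Real.exp_pos _).ne' hα.ne', Real.log_exp] at h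
  linarith

theorem add_exp_neg_nonneg (x : ℝ) : 0 ≤ x + Real.exp (-x) := by
  linarith [Real.add_one_le_exp (-x)]

open Classical in
/-- The pathwise inequality behind the lower bound. -/
theorem neg_log_mul_indicator_le (p : Triplet M Ω) (hp : 𝓜.IsPolicy p) {α : ℝ} (hα : 0 < α)
    (A U : Finset (Fin M)) (k N : ℕ) (ω : Ω) :
    {ω | p.T ω ≤ N ∧ (symmDiff A (p.Δ ω)).card < k}.indicator (fun _ => -Real.log α) ω ≤
      ∑ i ∈ U, (𝓜.slr A (stopped p.R p.T) i N ω +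
        Real.exp (-𝓜.slr A (stopped p.R p.T) i N ω)) +
      ∑ D with (symmDiff A D).card < k, ∑ n ∈ Finset.Icc 1 N,
        {ω | p.T ω = n ∧ p.Δ ω = D}.indicator
          (fun ω => Real.exp (-∑ i ∈ U \ symmDiff A D, 𝓜.slr A p.R i n ω)) ω / α := by
  have hterm : ∀ (D : Finset (Fin M)) (n : ℕ), 0 ≤ {ω | p.T ω = n ∧ p.Δ ω = D}.indicator
      (fun ω => Real.exp (-∑ i ∈ U \ symmDiff A D, 𝓜.slr A p.R i n ω)) ω / α := fun D n =>
    div_nonneg (Set.indicator_nonneg (fun _ _ => (Real.exp_pos _).le) _) hα.le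
  by_cases h : p.T ω ≤ N ∧ (symmDiff A (p.Δ ω)).card < k
  · rw [Set.indicator_of_mem (by exact h)]
    obtain ⟨n, hn⟩ := ENat.ne_top_iff_exists.1 (ne_top_of_le_ne_top (ENat.natCast_ne_top N) h.1)
    have h1 := hp.2.1 ω
    have h2 := h.1
    rw [← hn] at h1 h2
    have h1' : 1 ≤ n := by exact_mod_cast h1
    have h2' : n ≤ N := by exact_mod_cast h2
    simp only [slr_stopped A hn.symm h2']
    set W := symmDiff A (p.Δ ω) with hW
    -- Only the term `D = p.Δ ω`, `n = p.T ω` of the double sum is nonzero. Summing over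
    -- deterministic pairs permits a change of measure at a fixed time and with a fixed set of
    -- flipped sources.
    have e1 : Real.exp (-∑ i ∈ U \ W, 𝓜.slr A p.R i n ω) / α ≤
        ∑ D with (symmDiff A D).card < k, ∑ n ∈ Finset.Icc 1 N,
          {ω | p.T ω = n ∧ p.Δ ω = D}.indicator
            (fun ω => Real.exp (-∑ i ∈ U \ symmDiff A D, 𝓜.slr A p.R i n ω)) ω / α := by
      refine le_trans ?_ (Finset.single_le_sum (fun D _ => Finset.sum_nonneg fun n _ => hterm D n)
        (Finset.mem_filter.2 ⟨Finset.mem_univ (p.Δ ω), h.2⟩))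
      refine le_trans ?_ (Finset.single_le_sum (fun n _ => hterm (p.Δ ω) n)
        (Finset.mem_Icc.2 ⟨h1', h2'⟩))
      rw [Set.indicator_of_mem (show ω ∈ {ω' | p.T ω' = n ∧ p.Δ ω' = p.Δ ω} from ⟨hn.symm, rfl⟩)]
    -- Each `s + exp (-s)` is nonnegative, so the sources of `U ∩ W` can be added back and the bound
    -- involves all of `U`.
    have e2 : ∑ i ∈ U \ W, 𝓜.slr A p.R i n ω ≤
        ∑ i ∈ U, (𝓜.slr A p.R i n ω + Real.exp (-𝓜.slr A p.R i n ω)) :=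
      (Finset.sum_le_sum fun i _ => by linarith [Real.exp_pos (-𝓜.slr A p.R i n ω)]).trans
        (Finset.sum_le_sum_of_subset_of_nonneg Finset.sdiff_subset fun i _ _ =>
          add_exp_neg_nonneg _)
    have e3 := neg_log_le_add_exp_div hα (∑ i ∈ U \ W, 𝓜.slr A p.R i n ω)
    linarith
  · rw [Set.indicator_of_notMem (by exact h)]
    exact add_nonneg (Finset.sum_nonneg fun i _ => add_exp_neg_nonneg _)
      (Finset.sum_nonneg fun D _ => Finset.sum_nonneg fun n _ => hterm D n)

theorem IsPolicy.integrable_and_integral_indicator {p : Triplet M Ω} (hp : 𝓜.IsPolicy p)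
    (A U D : Finset (Fin M)) {n : ℕ} (hn : 1 ≤ n) :
    Integrable ({ω | p.T ω = n ∧ p.Δ ω = D}.indicator
        fun ω => Real.exp (-∑ i ∈ U, 𝓜.slr A p.R i n ω)) (𝓜.P A) ∧
      ∫ ω, {ω | p.T ω = n ∧ p.Δ ω = D}.indicator
        (fun ω => Real.exp (-∑ i ∈ U, 𝓜.slr A p.R i n ω)) ω ∂𝓜.P A =
        (𝓜.P (symmDiff A U)).real {ω | p.T ω = n ∧ p.Δ ω = D} := by
  have hP := 𝓜.isProbabilityMeasure (symmDiff A U)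
  have hE := hp.2.2.2 n hn D
  have hE' := hp.1.filt_le n _ hE
  have hl := hp.1.setLIntegral_lr A U n hE
  have hm : Measurable fun ω => Real.exp (-∑ i ∈ U, 𝓜.slr A p.R i n ω) :=
    Real.measurable_exp.comp (U.measurable_sum fun i _ =>
      (hp.1.measurable_slr A i n).mono (hp.1.filt_le n) le_rfl).neg
  have hint : IntegrableOn (fun ω => Real.exp (-∑ i ∈ U, 𝓜.slr A p.R i n ω))
      {ω | p.T ω = n ∧ p.Δ ω = D} (𝓜.P A) := by
    refine ⟨hm.aestronglyMeasurable, ?_⟩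
    rw [hasFiniteIntegral_iff_ofReal (Eventually.of_forall fun x => (Real.exp_pos _).le)]
    exact hl.trans_lt (measure_lt_top _ _)
  refine ⟨hint.integrable_indicator hE', ?_⟩
  rw [integral_indicator hE', integral_eq_lintegral_of_nonneg_ae
    (Eventually.of_forall fun x => (Real.exp_pos _).le) hm.aestronglyMeasurable]
  exact congrArg ENNReal.toReal hl

-- All of `U` is wrong after the flip: a source of `U` already in error is left alone, and a
-- correctly classified one becomes an error.
open Classical in
theorem le_card_symmDiff_of_sdiff {k : ℕ} (A D U : Finset (Fin M)) (hU : U.card = k) :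
    k ≤ (symmDiff (symmDiff A (U \ symmDiff A D)) D).card := by
  rw [← hU]
  refine Finset.card_le_card fun i hi => ?_
  simp only [Finset.mem_symmDiff, Finset.mem_sdiff, hi, true_and]
  tauto

theorem sum_measure_stop_le {p : Triplet M Ω} (hp : 𝓜.IsPolicy p) {α : ℝ}
    (hα : 0 < α) {k : ℕ} (herr : 𝓜.ErrorConstraint α k p) (B D : Finset (Fin M))
    (h : k ≤ (symmDiff B D).card) (N : ℕ) :
    ∑ n ∈ Finset.Icc 1 N, (𝓜.P B).real {ω | p.T ω = n ∧ p.Δ ω = D} ≤ α := by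
  have hP := 𝓜.isProbabilityMeasure B
  rw [← measureReal_biUnion_finset]
  · refine ENNReal.toReal_le_of_le_ofReal hα.le (le_trans (measure_mono ?_) (herr B))
    refine Set.iUnion₂_subset fun n _ ω hω => ⟨?_, ?_⟩
    · rw [hω.1]; exact ENat.natCast_ne_top n
    · rw [hω.2]
      convert h
  · intro m _ n _ hmn
    refine Set.disjoint_left.2 fun ω h1 h2 => hmn ?_
    have := h1.1.symm.trans h2.1
    exact_mod_cast this
  · exact fun n hn => hp.1.filt_le n _ (hp.2.2.2 n (Finset.mem_Icc.1 hn).1 D)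

theorem integrable_exp_neg_slr (A : Finset (Fin M)) (i : Fin M)
    (hR : ∀ n, MeasurableSet[𝓜.past n] {ω | i ∈ R (n + 1) ω}) (n : ℕ) :
    Integrable (fun ω => Real.exp (-𝓜.slr A R i n ω)) (𝓜.P A) := by
  refine ⟨(Real.measurable_exp.comp
    (measurable_slr_of_predictable A i hR n).neg).aestronglyMeasurable, ?_⟩
  rw [hasFiniteIntegral_iff_ofReal (Eventually.of_forall fun x => (Real.exp_pos _).le),
    lintegral_exp_neg_slr A i hR]
  exact ENNReal.one_lt_top

theorem integral_exp_neg_slr (A : Finset (Fin M)) (i : Fin M)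
    (hR : ∀ n, MeasurableSet[𝓜.past n] {ω | i ∈ R (n + 1) ω}) (n : ℕ) :
    ∫ ω, Real.exp (-𝓜.slr A R i n ω) ∂𝓜.P A = 1 := by
  rw [integral_eq_lintegral_of_nonneg_ae (Eventually.of_forall fun x => (Real.exp_pos _).le)
    (integrable_exp_neg_slr A i hR n).aestronglyMeasurable, lintegral_exp_neg_slr A i hR]
  rfl

open Classical in
theorem IsPolicy.measurableSet_stop_card_lt {p : Triplet M Ω} (hp : 𝓜.IsPolicy p)
    (A : Finset (Fin M)) (k N : ℕ) :
    MeasurableSet {ω | p.T ω ≤ N ∧ (symmDiff A (p.Δ ω)).card < k} := by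
  have : {ω | p.T ω ≤ N ∧ (symmDiff A (p.Δ ω)).card < k} =
      ⋃ n ∈ Finset.Icc 1 N, ⋃ D ∈ {D : Finset (Fin M) | (symmDiff A D).card < k},
        {ω | p.T ω = n ∧ p.Δ ω = D} := by
    ext ω
    simp only [Set.mem_ofPred_eq, Set.mem_iUnion, exists_prop, Finset.mem_Icc]
    constructor
    · rintro ⟨h1, h2⟩
      obtain ⟨n, hn⟩ :=
        ENat.ne_top_iff_exists.1 (ne_top_of_le_ne_top (ENat.natCast_ne_top N) h1)
      have h3 := hp.2.1 ω
      rw [← hn] at h1 h3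
      exact ⟨n, ⟨by exact_mod_cast h3, by exact_mod_cast h1⟩, _, h2, hn.symm, rfl⟩
    · rintro ⟨n, ⟨-, h1⟩, D, h2, h3, rfl⟩
      exact ⟨by rw [h3]; exact_mod_cast h1, h2⟩
  rw [this]
  refine Finset.measurableSet_biUnion _ fun n hn =>
    MeasurableSet.biUnion (Set.to_countable _) fun D _ => ?_
  exact hp.1.filt_le n _ (hp.2.2.2 n (Finset.mem_Icc.1 hn).1 D)

-- Integrated form of the pathwise inequality. The constant `k` comes from `exp (-slr)` having mean
-- one for each source of `U`; `2 ^ M` counts the possible decisions `D`, each contributing at most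
-- one by the error constraint under the flipped measure.
open Classical in
theorem IsPolicy.neg_log_mul_measure_le {p : Triplet M Ω} (hp : 𝓜.IsPolicy p) {α : ℝ}
    (hα : 0 < α) {k : ℕ} (herr : 𝓜.ErrorConstraint α k p) (A U : Finset (Fin M))
    (hU : U.card = k) (N : ℕ) :
    -Real.log α * (𝓜.P A).real {ω | p.T ω ≤ N ∧ (symmDiff A (p.Δ ω)).card < k} ≤
      ∑ i ∈ U, 𝓜.info A i * ∫ ω, count (stopped p.R p.T) i N ω ∂𝓜.P A + (k + 2 ^ M) := by
  have hP := 𝓜.isProbabilityMeasure A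
  have hpred := fun i n => hp.predictable_stopped i n
  have hms := hp.measurableSet_stop_card_lt A k N
  have hi1 : ∀ i ∈ U, Integrable (fun ω => 𝓜.slr A (stopped p.R p.T) i N ω +
      Real.exp (-𝓜.slr A (stopped p.R p.T) i N ω)) (𝓜.P A) := fun i _ =>
    (integrable_slr A i (hpred i) N).add (integrable_exp_neg_slr A i (hpred i) N)
  have hi2 : ∀ D, ∀ n ∈ Finset.Icc 1 N, Integrable (fun ω =>
      {ω | p.T ω = n ∧ p.Δ ω = D}.indicator
        (fun ω => Real.exp (-∑ i ∈ U \ symmDiff A D, 𝓜.slr A p.R i n ω)) ω / α) (𝓜.P A) :=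
    fun D n hn => (hp.integrable_and_integral_indicator A (U \ symmDiff A D) D
      (Finset.mem_Icc.1 hn).1).1.div_const α
  have hmain := integral_mono ((integrable_const (-Real.log α)).indicator hms)
    ((integrable_finsetSum _ hi1).add (integrable_finsetSum _ fun D _ =>
      integrable_finsetSum _ (hi2 D)))
    (fun ω => neg_log_mul_indicator_le p hp hα A U k N ω)
  rw [integral_indicator_const _ hms, smul_eq_mul, mul_comm] at hmain
  refine hmain.trans ?_
  rw [integral_add' (integrable_finsetSum _ hi1) (integrable_finsetSum _ fun D _ =>
      integrable_finsetSum _ (hi2 D)), integral_finsetSum _ hi1,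
    integral_finsetSum _ fun D _ => integrable_finsetSum _ (hi2 D)]
  have h1 : ∑ i ∈ U, ∫ ω, (𝓜.slr A (stopped p.R p.T) i N ω +
      Real.exp (-𝓜.slr A (stopped p.R p.T) i N ω)) ∂𝓜.P A =
      ∑ i ∈ U, 𝓜.info A i * ∫ ω, count (stopped p.R p.T) i N ω ∂𝓜.P A + k := by
    rw [← hU, Finset.card_eq_sum_ones, Nat.cast_sum, ← Finset.sum_add_distrib]
    refine Finset.sum_congr rfl fun i _ => ?_
    rw [integral_add (integrable_slr A i (hpred i) N) (integrable_exp_neg_slr A i (hpred i) N),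
      integral_slr A i (hpred i), integral_exp_neg_slr A i (hpred i), Nat.cast_one]
  have h2 : ∀ D, ∫ ω, ∑ n ∈ Finset.Icc 1 N, {ω | p.T ω = n ∧ p.Δ ω = D}.indicator
      (fun ω => Real.exp (-∑ i ∈ U \ symmDiff A D, 𝓜.slr A p.R i n ω)) ω / α ∂𝓜.P A ≤ 1 := by
    intro D
    rw [integral_finsetSum _ (hi2 D)]
    have : ∀ n ∈ Finset.Icc 1 N, ∫ ω, {ω | p.T ω = n ∧ p.Δ ω = D}.indicator
        (fun ω => Real.exp (-∑ i ∈ U \ symmDiff A D, 𝓜.slr A p.R i n ω)) ω / α ∂𝓜.P A =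
        (𝓜.P (symmDiff A (U \ symmDiff A D))).real {ω | p.T ω = n ∧ p.Δ ω = D} / α := by
      intro n hn
      rw [integral_div, (hp.integrable_and_integral_indicator A (U \ symmDiff A D) D
        (Finset.mem_Icc.1 hn).1).2]
    rw [Finset.sum_congr rfl this, ← Finset.sum_div, div_le_one hα]
    have := sum_measure_stop_le hp hα herr (symmDiff A (U \ symmDiff A D)) D
      (by convert le_card_symmDiff_of_sdiff A D U hU) N
    convert this
  have h3 : ∑ D with (symmDiff A D).card < k,
      ∫ ω, ∑ n ∈ Finset.Icc 1 N, {ω | p.T ω = n ∧ p.Δ ω = D}.indicator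
      (fun ω => Real.exp (-∑ i ∈ U \ symmDiff A D, 𝓜.slr A p.R i n ω)) ω / α ∂𝓜.P A ≤
      2 ^ M := by
    refine (Finset.sum_le_card_nsmul _ _ 1 fun D _ => h2 D).trans ?_
    rw [nsmul_eq_mul, mul_one]
    have : (Finset.univ.filter fun D : Finset (Fin M) => (symmDiff A D).card < k).card ≤ 2 ^ M := by
      refine (Finset.card_filter_le _ _).trans ?_
      simp
    exact_mod_cast this
  rw [h1]
  linarith

/-- The non-asymptotic lower bound on the expected time of a policy. -/
theorem neg_log_mul_le_of_mem_policyClass {p : Triplet M Ω} {α : ℝ} (h0 : 0 < α) {k : ℕ}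
    (hkM : k ≤ M) {K : ℝ} (h1 : α < 1) {A : Finset (Fin M)} {c' : Fin M → ℝ}
    (hc' : IsMaximizer k K (𝓜.F A) c') (hp : p ∈ 𝓜.policyClass α k K)
    (hfin : 𝓜.expT A p.T ≠ ⊤) :
    -Real.log α * (1 - α) ≤
      optValue k K (𝓜.F A) * (𝓜.expT A p.T).toReal + (k + 2 ^ M) := by
  classical
  have hP := 𝓜.isProbabilityMeasure A
  obtain ⟨hpol, hsamp, herr⟩ := hp
  have hTn : ∀ n : ℕ, MeasurableSet {ω | p.T ω = n} := by
    intro n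
    rcases Nat.eq_zero_or_pos n with rfl | hn
    · convert MeasurableSet.empty
      ext ω
      have := hpol.2.1 ω
      simp only [Set.mem_ofPred_eq, Set.mem_empty_iff_false, iff_false]
      intro h
      rw [h] at this
      simp at this
    · exact hpol.1.filt_le n _ (hpol.2.2.1 n hn)
  have hTm : Measurable p.T := by
    refine measurable_to_countable' fun x => ?_
    induction x using ENat.recTopCoe with
    | top =>
      have : p.T ⁻¹' {⊤} = (⋃ n : ℕ, {ω | p.T ω = n})ᶜ := by
        ext ω
        simp only [Set.mem_preimage, Set.mem_singleton_iff, Set.mem_compl_iff, Set.mem_iUnion,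
          Set.mem_ofPred_eq]
        rw [← not_iff_not, not_not, ← ne_eq, ENat.ne_top_iff_exists]
        simp [eq_comm]
      rw [this]
      exact (MeasurableSet.iUnion hTn).compl
    | coe n => exact hTn n
  have hTe : Measurable fun ω => (p.T ω : ℝ≥0∞) := (measurable_of_countable _).comp hTm
  have hae : ∀ᵐ ω ∂𝓜.P A, p.T ω ≠ ⊤ := by
    filter_upwards [ae_lt_top hTe hfin] with ω hω h
    simp [h] at hω
  have hτ : Integrable (fun ω => (p.T ω : ℝ≥0∞).toReal) (𝓜.P A) :=
    integrable_toReal_of_lintegral_ne_top hTe.aemeasurable hfin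
  set e := (𝓜.expT A p.T).toReal with he
  have heq : ∫ ω, (p.T ω : ℝ≥0∞).toReal ∂𝓜.P A = e :=
    integral_toReal hTe.aemeasurable (ae_lt_top hTe hfin)
  have he1 : 1 ≤ e := by
    have : (1 : ℝ≥0∞) ≤ 𝓜.expT A p.T := by
      calc (1 : ℝ≥0∞) = ∫⁻ _, 1 ∂𝓜.P A := by simp
        _ ≤ _ := lintegral_mono fun ω => by simpa using ENat.toENNReal_le.2 (hpol.2.1 ω)
    simpa using (ENNReal.toReal_le_toReal ENNReal.one_ne_top hfin).2 this
  have he0 : 0 < e := by linarith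
  have hN : ∀ N : ℕ,
      -Real.log α * (𝓜.P A).real {ω | p.T ω ≤ N ∧ (symmDiff A (p.Δ ω)).card < k} ≤
      optValue k K (𝓜.F A) * e + (k + 2 ^ M) := by
    intro N
    have hpred := fun i n => hpol.predictable_stopped i n
    have hcint := fun i => integrable_count (𝓜 := 𝓜) A i (hpred i) N
    -- The expected sampling frequencies of the stopped rule, truncated at `N`. No source is sampled
    -- more than `T` times, and the sampling constraint bounds the total by `K * T`, so they form a
    -- feasible allocation.
    let c : Fin M → ℝ := fun i => (∫ ω, count (stopped p.R p.T) i N ω ∂𝓜.P A) / e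
    have hc : c ∈ allocSet M K := by
      refine ⟨fun i => ⟨div_nonneg (integral_nonneg fun ω => count_nonneg i N ω) he0.le, ?_⟩, ?_⟩
      · rw [div_le_one he0, ← heq]
        refine integral_mono_ae (hcint i) hτ ?_
        filter_upwards [hae] with ω hω
        obtain ⟨n, hn⟩ := ENat.ne_top_iff_exists.1 hω
        refine (count_stopped_le hn.symm i N).trans ((count_le i n ω).trans ?_)
        simp [← hn]
      · simp only [c]
        rw [← Finset.sum_div, div_le_iff₀ he0, ← heq, ← integral_const_mul,
          ← integral_finsetSum _ fun i _ => hcint i]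
        refine integral_mono_ae (integrable_finsetSum _ fun i _ => hcint i) (hτ.const_mul K) ?_
        filter_upwards [hae, hsamp A] with ω hω hs
        obtain ⟨n, hn⟩ := ENat.ne_top_iff_exists.1 hω
        have hs' := hs n hn.symm
        have hn1 : (0 : ℝ) < n := by
          have := hpol.2.1 ω
          rw [← hn] at this
          have : 1 ≤ n := by exact_mod_cast this
          exact_mod_cast this
        rw [div_le_iff₀ hn1, ← sum_count] at hs'
        refine (Finset.sum_le_sum fun i _ => count_stopped_le hn.symm i N).trans (hs'.trans ?_)
        simp [← hn]
    obtain ⟨U, hU, hle⟩ := exists_sum_mul_info_le_optValue hc' hkM hc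
    refine (hpol.neg_log_mul_measure_le h0 herr A U hU N).trans ?_
    have : ∑ i ∈ U, 𝓜.info A i * ∫ ω, count (stopped p.R p.T) i N ω ∂𝓜.P A =
        (∑ i ∈ U, c i * 𝓜.info A i) * e := by
      rw [Finset.sum_mul]
      refine Finset.sum_congr rfl fun i _ => ?_
      simp only [c]
      field_simp
    rw [this]
    have := mul_le_mul_of_nonneg_right hle he0.le
    linarith
  have hlim : Tendsto (fun N : ℕ =>
      (𝓜.P A).real {ω | p.T ω ≤ N ∧ (symmDiff A (p.Δ ω)).card < k}) atTop
      (𝓝 ((𝓜.P A).real (⋃ N : ℕ, {ω | p.T ω ≤ N ∧ (symmDiff A (p.Δ ω)).card < k}))) := by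
    refine (ENNReal.tendsto_toReal (measure_ne_top _ _)).comp (tendsto_measure_iUnion_atTop ?_)
    intro m n hmn ω hω
    exact ⟨hω.1.trans (by exact_mod_cast hmn), hω.2⟩
  have hbound := le_of_tendsto' (hlim.const_mul (-Real.log α)) hN
  -- `T` is almost surely finite, so the complementary event is, up to a null set, that of stopping
  -- with at least `k` errors.
  have hge : 1 - α ≤
      (𝓜.P A).real (⋃ N : ℕ, {ω | p.T ω ≤ N ∧ (symmDiff A (p.Δ ω)).card < k}) := by
    set G := ⋃ N : ℕ, {ω | p.T ω ≤ N ∧ (symmDiff A (p.Δ ω)).card < k} with hG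
    have hGm : MeasurableSet G :=
      MeasurableSet.iUnion fun N => hpol.measurableSet_stop_card_lt A k N
    have hcompl : (𝓜.P A).real Gᶜ ≤ α := by
      refine ENNReal.toReal_le_of_le_ofReal h0.le (le_trans (measure_mono_ae ?_) (herr A))
      filter_upwards [hae] with ω hω hc
      refine ⟨hω, ?_⟩
      by_contra hcon
      obtain ⟨n, hn⟩ := ENat.ne_top_iff_exists.1 hω
      refine hc (Set.mem_iUnion.2 ⟨n, hn.symm.le, ?_⟩)
      convert not_le.1 hcon
    rw [probReal_compl_eq_one_sub hGm] at hcompl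
    linarith
  refine le_trans ?_ hbound
  exact mul_le_mul_of_nonneg_left hge (neg_nonneg.2 (Real.log_nonpos h0.le h1.le))

end Model

namespace Model

variable {M : ℕ} {S Ω : Type*} [MeasurableSpace S] [MeasurableSpace Ω] {𝓜 : Model M S Ω}
  {R : ℕ → Ω → Finset (Fin M)}

/-! ### The expected time of the sum-intersection rule -/

/-- A small `|llr|` means that the source was sampled too rarely, which is summable by `hfreq`, or
that the log-likelihood ratio is low despite enough samples, which has exponentially small
probability. -/
theorem IsSamplingRule.summable_measure_abs_llr_lt (hR : 𝓜.IsSamplingRule R)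
    (A : Finset (Fin M)) (i : Fin M) {c : ℝ} (hc1 : c ≤ 1)
    (hfreq : ∀ ε > 0, Summable fun n : ℕ => (𝓜.P A).real {ω | freq R i (n + 1) ω < c - ε})
    {δ : ℝ} (hδ : 0 < δ) :
    Summable fun n : ℕ => (𝓜.P A).real
      {ω | |𝓜.llr R i (n + 1) ω| < ((n + 1 : ℕ) : ℝ) * (c * 𝓜.info A i - δ)} := by
  have hP := 𝓜.isProbabilityMeasure A
  have hF := 𝓜.info_pos A i
  set f := 𝓜.info A i
  -- If `c * f ≤ δ` the bound is nonpositive and the event is empty. Otherwise `c` is positive and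
  -- the Chernoff bound has a positive sampling rate available.
  rcases le_or_gt (c * f) δ with hle | hlt
  · have : ∀ n : ℕ, {ω | |𝓜.llr R i (n + 1) ω| < ((n + 1 : ℕ) : ℝ) * (c * f - δ)} = ∅ := by
      intro n
      refine Set.eq_empty_of_forall_notMem fun ω hω => ?_
      have h1 : ((n + 1 : ℕ) : ℝ) * (c * f - δ) ≤ 0 :=
        mul_nonpos_of_nonneg_of_nonpos (Nat.cast_nonneg _) (by linarith)
      exact absurd (lt_of_lt_of_le hω h1) (not_lt.2 (abs_nonneg _))
    simp only [this, measureReal_empty]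
    exact summable_zero
  -- The slack `δ` is split between the frequency and the mean: `(f - δ / 2) * (c - ε) ≥ c * f - δ`,
  -- using `c ≤ 1` and `ε * f = δ / 2`.
  set ε := δ / (2 * f) with hε
  have hε0 : 0 < ε := by positivity
  have hεf : ε * f = δ / 2 := by rw [hε]; field_simp
  have hρ : 0 < c - ε := by
    by_contra hcon
    have := mul_le_mul_of_nonneg_right (not_lt.1 hcon) hF.le
    rw [sub_mul, hεf] at this
    linarith
  have hf : δ < f := by nlinarith
  obtain ⟨b, hb, hdev⟩ := exists_measure_slr_le_exp (𝓜 := 𝓜) (R := R) A i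
    (fun n => hR.filt_le_past n _ (hR.measurableSet_mem n fun D => i ∈ D)) hρ
    (show f - δ / 2 < 𝓜.info A i by simp only [f]; linarith)
  have hsum : Summable fun n : ℕ => Real.exp (-(b * ((n + 1 : ℕ) : ℝ))) := by
    have := (Real.summable_exp_nat_mul_iff (a := -b)).2 (by linarith)
    refine ((summable_nat_add_iff 1).2 this).congr fun n => ?_
    congr 1
    ring
  refine Summable.of_nonneg_of_le (fun n => measureReal_nonneg) (fun n => ?_)
    ((hfreq ε hε0).add hsum)
  refine le_trans (le_trans (measureReal_mono ?_) (measureReal_union_le _ _))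
    (add_le_add_right (hdev (n + 1)) _)
  intro ω hω
  by_cases h : freq R i (n + 1) ω < c - ε
  · exact Or.inl h
  · right
    have hn : (0 : ℝ) < ((n + 1 : ℕ) : ℝ) := by positivity
    have hcount : (c - ε) * ((n + 1 : ℕ) : ℝ) ≤ count R i (n + 1) ω := by
      rw [not_lt, freq, le_div_iff₀ hn] at h
      exact h
    refine ⟨hcount, ?_⟩
    have h1 : 𝓜.slr A R i (n + 1) ω < ((n + 1 : ℕ) : ℝ) * (c * f - δ) :=
      ((le_abs_self _).trans (abs_slr A i (n + 1) ω).le).trans_lt hω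
    have h2 : (f - δ / 2) * ((c - ε) * ((n + 1 : ℕ) : ℝ)) ≤
        (f - δ / 2) * count R i (n + 1) ω :=
      mul_le_mul_of_nonneg_left hcount (by linarith)
    have h3 : c * f - δ ≤ (f - δ / 2) * (c - ε) := by nlinarith
    have h4 := mul_le_mul_of_nonneg_left h3 hn.le
    linarith

/-- Tail-sum formula, with the indices below `n₀` bounded trivially by one each. -/
theorem toENNReal_le_add_tsum (T : ℕ∞) (n₀ : ℕ) :
    (T : ℝ≥0∞) ≤ n₀ + ∑' j : ℕ, if ((n₀ + j : ℕ) : ℕ∞) < T then (1 : ℝ≥0∞) else 0 := by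
  induction T using ENat.recTopCoe with
  | top =>
    have : ∑' j : ℕ, (if ((n₀ + j : ℕ) : ℕ∞) < ⊤ then (1 : ℝ≥0∞) else 0) = ⊤ := by
      simp only [ENat.natCast_lt_top, if_true]
      exact ENNReal.tsum_const_eq_top_of_ne_zero one_ne_zero
    rw [this]; simp
  | coe n =>
    have h : ((n - n₀ : ℕ) : ℝ≥0∞) ≤
        ∑' j : ℕ, if ((n₀ + j : ℕ) : ℕ∞) < (n : ℕ∞) then (1 : ℝ≥0∞) else 0 := by
      calc ((n - n₀ : ℕ) : ℝ≥0∞) = ∑ j ∈ Finset.range (n - n₀),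
            if ((n₀ + j : ℕ) : ℕ∞) < (n : ℕ∞) then (1 : ℝ≥0∞) else 0 := by
            rw [Finset.sum_congr rfl fun j hj => if_pos ?_]
            · simp
            · have := Finset.mem_range.1 hj
              exact_mod_cast (by omega : n₀ + j < n)
        _ ≤ _ := ENNReal.sum_le_tsum _
    refine le_trans ?_ (add_le_add_right h _)
    rw [ENat.toENNReal_coe, ← Nat.cast_add]
    exact_mod_cast (by omega : n ≤ n₀ + (n - n₀))

/-- A linear bound on the expected time of the sum-intersection rule. -/
theorem IsSamplingRule.exists_expT_siTime_le (hR : 𝓜.IsSamplingRule R) {k : ℕ} (hkM : k ≤ M)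
    (A : Finset (Fin M)) {c : Fin M → ℝ} (hc1 : ∀ i, c i ≤ 1) {V : ℝ}
    (hV : ∀ U : Finset (Fin M), U.card = k → V ≤ ∑ i ∈ U, c i * 𝓜.info A i)
    (hfreq : ∀ i, ∀ ε > 0,
      Summable fun n : ℕ => (𝓜.P A).real {ω | freq R i (n + 1) ω < c i - ε})
    {δ : ℝ} (hδ : 0 < δ) (hδV : k * δ < V) :
    ∃ C : ℝ, ∀ d, 0 < d →
      𝓜.expT A (𝓜.siTime R k d) ≤ ENNReal.ofReal (d / (V - k * δ) + C) := by
  have hP := 𝓜.isProbabilityMeasure A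
  have hV' : 0 < V - k * δ := by linarith
  set E : Fin M → ℕ → Set Ω := fun i n =>
    {ω | |𝓜.llr R i n ω| < (n : ℝ) * (c i * 𝓜.info A i - δ)} with hE
  have hEm : ∀ i n, MeasurableSet (E i n) := fun i n =>
    measurableSet_lt (measurable_abs.comp
      ((hR.measurable_llr i n).mono (hR.filt_le n) le_rfl)) measurable_const
  have hs : ∀ i, ∑' n, 𝓜.P A (E i (n + 1)) ≠ ⊤ := fun i =>
    (hR.summable_measure_abs_llr_lt A i (hc1 i) (hfreq i) hδ).tsum_ofReal_ne_top |> fun h => by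
      simpa [E, measureReal_def, ENNReal.ofReal_toReal] using h
  set B : ℝ≥0∞ := ∑ i, ∑' n, 𝓜.P A (E i (n + 1)) with hB
  have hBfin : B ≠ ⊤ := ENNReal.sum_ne_top.2 fun i _ => hs i
  refine ⟨1 + B.toReal, fun d hd => ?_⟩
  -- From `n₀` on, `n * (V - k * δ)` is at least `d`. If the rule has not stopped by then, some `k`
  -- values `|llr|` add up to less than `n * (V - k * δ)`, and one of them must be below its own
  -- share. The tail sum `B` does not depend on `d`.
  set n₀ := ⌈d / (V - k * δ)⌉₊ with hn₀
  have hn₀1 : 1 ≤ n₀ := Nat.one_le_ceil_iff.2 (by positivity)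
  have hpt : ∀ ω, (𝓜.siTime R k d ω : ℝ≥0∞) ≤
      n₀ + ∑' j : ℕ, ∑ i, (E i (n₀ + j)).indicator (1 : Ω → ℝ≥0∞) ω := by
    intro ω
    refine (toENNReal_le_add_tsum _ n₀).trans (add_le_add_right (ENNReal.tsum_le_tsum fun j => ?_) _)
    split_ifs with h
    · have hnc : ¬ 𝓜.SiCross R k d (n₀ + j) ω := fun hcr =>
        absurd (siTime_le hkM (by omega) hcr) (not_le.2 h)
      unfold SiCross at hnc
      push Not at hnc
      obtain ⟨U, hU, hlt⟩ := hnc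
      have hd' : d ≤ ((n₀ + j : ℕ) : ℝ) * (V - k * δ) := by
        rw [← div_le_iff₀ hV']
        refine (Nat.le_ceil _).trans ?_
        exact_mod_cast (by omega : ⌈d / (V - k * δ)⌉₊ ≤ n₀ + j)
      have hsum : ∑ i ∈ U, |𝓜.llr R i (n₀ + j) ω| <
          ∑ i ∈ U, ((n₀ + j : ℕ) : ℝ) * (c i * 𝓜.info A i - δ) := by
        refine hlt.trans_le (hd'.trans ?_)
        rw [← Finset.mul_sum, Finset.sum_sub_distrib, Finset.sum_const, hU, nsmul_eq_mul]
        exact mul_le_mul_of_nonneg_left (by linarith [hV U hU]) (Nat.cast_nonneg _)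
      obtain ⟨i, -, hi⟩ := Finset.exists_lt_of_sum_lt hsum
      refine le_trans ?_ (Finset.single_le_sum (fun i _ => zero_le) (Finset.mem_univ i))
      rw [Set.indicator_of_mem (by exact hi)]
      rfl
    · exact zero_le
  have hint : ∫⁻ ω, ∑' j : ℕ, ∑ i, (E i (n₀ + j)).indicator (1 : Ω → ℝ≥0∞) ω ∂𝓜.P A ≤ B := by
    have hmeas : ∀ i j, Measurable ((E i (n₀ + j)).indicator (1 : Ω → ℝ≥0∞)) := fun i j =>
      measurable_one.indicator (hEm i _)
    rw [lintegral_tsum fun j => (Finset.measurable_sum _ fun i _ => hmeas i j).aemeasurable]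
    have : ∀ j, ∫⁻ ω, ∑ i, (E i (n₀ + j)).indicator (1 : Ω → ℝ≥0∞) ω ∂𝓜.P A =
        ∑ i, 𝓜.P A (E i (n₀ + j)) := fun j => by
      rw [lintegral_finsetSum _ fun i _ => hmeas i j]
      exact Finset.sum_congr rfl fun i _ => lintegral_indicator_one (hEm i _)
    simp only [this]
    rw [Summable.tsum_finsetSum fun i _ => ENNReal.summable]
    refine Finset.sum_le_sum fun i _ => ?_
    -- The series in `B` starts at time 1, so time `n₀ + j` is its term of index `n₀ - 1 + j`; this
    -- uses `1 ≤ n₀`.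
    have hinj : Function.Injective fun j => n₀ - 1 + j := add_right_injective _
    refine le_of_eq_of_le (tsum_congr fun j => ?_)
      (ENNReal.tsum_comp_le_tsum_of_injective hinj fun n => 𝓜.P A (E i (n + 1)))
    congr 2
    omega
  calc 𝓜.expT A (𝓜.siTime R k d)
      ≤ ∫⁻ ω, (n₀ + ∑' j : ℕ, ∑ i, (E i (n₀ + j)).indicator (1 : Ω → ℝ≥0∞) ω) ∂𝓜.P A :=
        lintegral_mono hpt
    _ ≤ n₀ + B := by
        rw [lintegral_add_left measurable_const, lintegral_const, measure_univ, mul_one]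
        exact add_le_add_right hint _
    _ = ENNReal.ofReal (n₀ + B.toReal) := by
        rw [ENNReal.ofReal_add (Nat.cast_nonneg _) ENNReal.toReal_nonneg,
          ENNReal.ofReal_natCast, ENNReal.ofReal_toReal hBfin]
    _ ≤ _ := by
        refine ENNReal.ofReal_le_ofReal ?_
        have := Nat.ceil_lt_add_one (show 0 ≤ d / (V - k * δ) by positivity)
        linarith

end Model

/-! ### Asymptotics -/

theorem tendsto_ofReal_div_ofReal {f g : ℝ → ℝ} {l : Filter ℝ} {a : ℝ}
    (hg : ∀ᶠ x in l, 0 < g x) (h : Tendsto (fun x => f x / g x) l (𝓝 a)) :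
    Tendsto (fun x => ENNReal.ofReal (f x) / ENNReal.ofReal (g x)) l (𝓝 (ENNReal.ofReal a)) := by
  refine ((ENNReal.continuous_ofReal.tendsto a).comp h).congr' ?_
  filter_upwards [hg] with x hx
  exact ENNReal.ofReal_div_of_pos hx

theorem tendsto_neg_log_nhdsGT_zero : Tendsto (fun α => -Real.log α) (𝓝[>] 0) atTop :=
  tendsto_neg_atBot_atTop.comp Real.tendsto_log_nhdsGT_zero

theorem eventually_mem_Ioo_nhdsGT_zero : ∀ᶠ α in 𝓝[>] (0 : ℝ), 0 < α ∧ α < 1 :=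
  Ioo_mem_nhdsGT one_pos

theorem eventually_scale_pos {V : ℝ} (hV : 0 < V) :
    ∀ᶠ α in 𝓝[>] (0 : ℝ), 0 < |Real.log α| / V := by
  filter_upwards [eventually_mem_Ioo_nhdsGT_zero] with α hα
  exact div_pos (abs_pos.2 (Real.log_neg hα.1 hα.2).ne) hV

/-- Two-sided linear bounds determine the first-order asymptotics. -/
theorem asympEquiv_of_bounds {x : ℝ → ℝ≥0∞} {V b c : ℝ} (hV : 0 < V)
    (hlow : ∀ᶠ α in 𝓝[>] (0 : ℝ),
      ENNReal.ofReal ((-Real.log α * (1 - α) - c) / V) ≤ x α)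
    (hup : ∀ V' : ℝ, 0 < V' → V' < V → ∃ C : ℝ, ∀ᶠ α in 𝓝[>] (0 : ℝ),
      x α ≤ ENNReal.ofReal ((|Real.log α| + b) / V' + C)) :
    AsympEquiv x fun α => ENNReal.ofReal (|Real.log α| / V) := by
  have hpos := eventually_scale_pos hV
  have hid : Tendsto (fun α : ℝ => α) (𝓝[>] 0) (𝓝 0) := nhdsWithin_le_nhds
  have hinv : ∀ C : ℝ, Tendsto (fun α => C / -Real.log α) (𝓝[>] 0) (𝓝 0) := fun C =>
    tendsto_neg_log_nhdsGT_zero.const_div_atTop C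
  refine tendsto_order.2 ⟨fun a ha => ?_, fun a ha => ?_⟩
  · have hlim : Tendsto (fun α => (-Real.log α * (1 - α) - c) / V / (|Real.log α| / V))
        (𝓝[>] 0) (𝓝 1) := by
      have h1 := (hid.const_sub 1).sub (hinv c)
      simp only [sub_zero] at h1
      refine h1.congr' ?_
      filter_upwards [eventually_mem_Ioo_nhdsGT_zero] with α hα
      have hl := Real.log_neg hα.1 hα.2
      rw [abs_of_neg hl]
      have hs : 0 < -Real.log α := by linarith
      generalize -Real.log α = s at hs
      field_simp
    have h2 := tendsto_ofReal_div_ofReal hpos hlim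
    rw [ENNReal.ofReal_one] at h2
    filter_upwards [h2.eventually (lt_mem_nhds ha), hlow] with α h3 h4
    exact h3.trans_le (ENNReal.div_le_div_right h4 _)
  · have hcont : Tendsto (fun V' : ℝ => ENNReal.ofReal (V / V')) (𝓝[<] V) (𝓝 1) := by
      have : Tendsto (fun V' : ℝ => V / V') (𝓝 V) (𝓝 (V / V)) :=
        tendsto_const_nhds.div tendsto_id hV.ne'
      rw [div_self hV.ne'] at this
      have h := (ENNReal.continuous_ofReal.tendsto 1).comp this
      rw [ENNReal.ofReal_one] at h
      exact h.mono_left nhdsWithin_le_nhds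
    -- Since `V / V'` tends to 1 as `V'` increases to `V`, fix `V'` with ratio below `a`; the
    -- remaining constants are negligible against `|log α|`.
    obtain ⟨V', hV'a, hV'0, hV'V⟩ :=
      ((hcont.eventually (gt_mem_nhds ha)).and (Ioo_mem_nhdsLT hV)).exists
    obtain ⟨C, hC⟩ := hup V' hV'0 hV'V
    have hlim : Tendsto (fun α => ((|Real.log α| + b) / V' + C) / (|Real.log α| / V))
        (𝓝[>] 0) (𝓝 (V / V')) := by
      have h1 := (hinv ((b / V' + C) * V)).const_add (V / V')
      rw [add_zero] at h1
      refine h1.congr' ?_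
      filter_upwards [eventually_mem_Ioo_nhdsGT_zero] with α hα
      have hl := Real.log_neg hα.1 hα.2
      rw [abs_of_neg hl]
      have hs : 0 < -Real.log α := by linarith
      generalize -Real.log α = s at hs
      field_simp
      ring
    have h2 := tendsto_ofReal_div_ofReal hpos hlim
    filter_upwards [h2.eventually (gt_mem_nhds hV'a), hC] with α h3 h4
    exact (ENNReal.div_le_div_right h4 _).trans_lt h3

theorem AsympEquiv.div_of_common {x y : ℝ → ℝ≥0∞} {l : ℝ → ℝ}
    (hl : ∀ᶠ α in 𝓝[>] (0 : ℝ), 0 < l α)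
    (hx : AsympEquiv x fun α => ENNReal.ofReal (l α))
    (hy : AsympEquiv y fun α => ENNReal.ofReal (l α)) : AsympEquiv x y := by
  have h := ENNReal.Tendsto.div hx (Or.inl one_ne_zero) hy (Or.inl ENNReal.one_ne_top)
  rw [ENNReal.div_self one_ne_zero ENNReal.one_ne_top] at h
  refine h.congr' ?_
  filter_upwards [hl] with α hα
  exact ENNReal.mul_div_mul_right (x α) (y α) (ENNReal.inv_ne_zero.2 ENNReal.ofReal_ne_top)
    (ENNReal.inv_ne_top.2 (ENNReal.ofReal_pos.2 hα).ne')

theorem Model.ofReal_le_optTime {M : ℕ} {S Ω : Type*} [MeasurableSpace S] [MeasurableSpace Ω]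
    {𝓜 : Model M S Ω} {α : ℝ} (h0 : 0 < α) (h1 : α < 1) {k : ℕ} (hkM : k ≤ M) {K : ℝ}
    {A : Finset (Fin M)} {c' : Fin M → ℝ} (hc' : IsMaximizer k K (𝓜.F A) c')
    (hV : 0 < optValue k K (𝓜.F A)) :
    ENNReal.ofReal ((-Real.log α * (1 - α) - (k + 2 ^ M)) / optValue k K (𝓜.F A)) ≤
      𝓜.optTime A α k K := by
  refine le_iInf₂ fun p hp => ?_
  by_cases hfin : 𝓜.expT A p.T = ⊤
  · rw [hfin]; exact le_top
  · rw [← ENNReal.ofReal_toReal hfin]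
    refine ENNReal.ofReal_le_ofReal ?_
    rw [div_le_iff₀ hV]
    have := Model.neg_log_mul_le_of_mem_policyClass h0 hkM h1 hc' hp hfin
    linarith

end AnomalyID

theorem mainTheorem1 {M : ℕ} {S Ω : Type*} [MeasurableSpace S] [MeasurableSpace Ω]
    (𝓜 : AnomalyID.Model M S Ω)
    (k : ℕ) (hk : 1 ≤ k) (hkM : k ≤ M)
    (K : ℝ) (hK : 0 < K) (hKM : K ≤ M)
    (A : Finset (Fin M))
    (R : ℕ → Ω → Finset (Fin M)) (hR : 𝓜.IsSamplingRule R)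
    (hsamp : ∀ᶠ α in 𝓝[>] (0 : ℝ),
      𝓜.SamplingConstraint K (𝓜.siPolicy R k (AnomalyID.threshold M k α)))
    (c' : Fin M → ℝ) (hc' : AnomalyID.IsMinNormMaximizer k K (𝓜.F A) c')
    (σ : Equiv.Perm (Fin M)) (hσ : Monotone (𝓜.info A ∘ σ))
    (cstar : Fin M → ℝ) (hcstar : ∀ i, cstar (σ i) = c' i)
    (hfreq : ∀ i, ∀ ε > 0,
      Summable fun n : ℕ => (𝓜.P A).real {ω | AnomalyID.freq R i (n + 1) ω < cstar i - ε}) :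
    (∀ᶠ α in 𝓝[>] (0 : ℝ),
      𝓜.siPolicy R k (AnomalyID.threshold M k α) ∈ 𝓜.policyClass α k K) ∧
    AnomalyID.AsympEquiv
      (fun α => 𝓜.expT A (𝓜.siTime R k (AnomalyID.threshold M k α)))
      (fun α => 𝓜.optTime A α k K) ∧
    AnomalyID.AsympEquiv
      (fun α => 𝓜.optTime A α k K)
      (fun α => ENNReal.ofReal (|Real.log α| / AnomalyID.optValue k K (𝓜.F A))) := by
  have hmax := hc'.1
  have hV : 0 < AnomalyID.optValue k K (𝓜.F A) :=
    hmax.optValue_pos hk hkM hK hKM fun i => 𝓜.info_pos A _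
  have hclass : ∀ᶠ α in 𝓝[>] (0 : ℝ),
      𝓜.siPolicy R k (AnomalyID.threshold M k α) ∈ 𝓜.policyClass α k K := by
    filter_upwards [hsamp, AnomalyID.eventually_mem_Ioo_nhdsGT_zero] with α h1 h2
    exact ⟨hR.isPolicy_siPolicy hkM _, h1, hR.errorConstraint_siPolicy hkM h2.1 h2.2⟩
  have hle : ∀ᶠ α in 𝓝[>] (0 : ℝ), 𝓜.optTime A α k K ≤
      𝓜.expT A (𝓜.siTime R k (AnomalyID.threshold M k α)) := by
    filter_upwards [hclass] with α hα
    exact iInf₂_le _ hα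
  have hlow : ∀ᶠ α in 𝓝[>] (0 : ℝ), ENNReal.ofReal ((-Real.log α * (1 - α) - (k + 2 ^ M)) /
      AnomalyID.optValue k K (𝓜.F A)) ≤ 𝓜.optTime A α k K := by
    filter_upwards [AnomalyID.eventually_mem_Ioo_nhdsGT_zero] with α hα
    exact AnomalyID.Model.ofReal_le_optTime hα.1 hα.2 hkM hmax hV
  -- The sorted vector does not depend on how ties are broken, so the given enumeration `σ` may
  -- replace `Tuple.sort`.
  have hF : 𝓜.F A = 𝓜.info A ∘ σ := (Tuple.comp_sort_eq_comp_iff_monotone.2 hσ).symm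
  have hVU : ∀ U : Finset (Fin M), U.card = k →
      AnomalyID.optValue k K (𝓜.F A) ≤ ∑ i ∈ U, cstar i * 𝓜.info A i := by
    intro U hU
    rw [hmax.optValue_eq]
    refine (AnomalyID.minSum_le (𝓜.F A) c'
      (U := U.map σ.symm.toEmbedding) (by simpa using hU)).trans_eq ?_
    simp [hF, ← hcstar]
  have hc1 : ∀ i, cstar i ≤ 1 := fun i => by
    have := (hmax.1.1 (σ.symm i)).2
    rwa [← hcstar, Equiv.apply_symm_apply] at this
  have hup : ∀ V' : ℝ, 0 < V' → V' < AnomalyID.optValue k K (𝓜.F A) →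
      ∃ C : ℝ, ∀ᶠ α in 𝓝[>] (0 : ℝ),
        𝓜.expT A (𝓜.siTime R k (AnomalyID.threshold M k α)) ≤
          ENNReal.ofReal ((|Real.log α| + Real.log (M.choose k : ℝ)) / V' + C) := by
    intro V' hV'0 hV'V
    have hk0 : (0 : ℝ) < k := by exact_mod_cast hk
    have hkδ : k * ((AnomalyID.optValue k K (𝓜.F A) - V') / k) =
        AnomalyID.optValue k K (𝓜.F A) - V' := mul_div_cancel₀ _ hk0.ne'
    -- This `δ` makes `V - k * δ` equal to the prescribed `V'`.
    obtain ⟨C, hC⟩ := hR.exists_expT_siTime_le hkM A hc1 hVU hfreq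
      (δ := (AnomalyID.optValue k K (𝓜.F A) - V') / k)
      (div_pos (by linarith) hk0) (by rw [hkδ]; linarith)
    rw [hkδ, sub_sub_cancel] at hC
    refine ⟨C, ?_⟩
    filter_upwards [AnomalyID.eventually_mem_Ioo_nhdsGT_zero] with α hα
    have hb : (1 : ℝ) ≤ M.choose k := by exact_mod_cast Nat.choose_pos hkM
    exact hC _ (add_pos_of_pos_of_nonneg (abs_pos.2 (Real.log_neg hα.1 hα.2).ne)
      (Real.log_nonneg hb))
  -- The optimal time inherits the upper bound from the sum-intersection rule, which lies in the
  -- class for small `α`; conversely, in `hsi` the rule inherits the universal lower bound.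
  have hopt := AnomalyID.asympEquiv_of_bounds hV hlow fun V' h1 h2 => by
    obtain ⟨C, hC⟩ := hup V' h1 h2
    refine ⟨C, ?_⟩
    filter_upwards [hC, hle] with α h3 h4
    exact h4.trans h3
  have hsi := AnomalyID.asympEquiv_of_bounds hV (hlow.and hle |>.mono fun α h => h.1.trans h.2) hup
  exact ⟨hclass, AnomalyID.AsympEquiv.div_of_common (AnomalyID.eventually_scale_pos hV) hsi hopt,
    hopt⟩
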